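/- Let $\mathrm{M}_n$ denote the complex $n\times n$ matrices. A standard monotone function is a function $f:(0,\infty)\to(0,\infty)$ that is matrix monotone (for positive definite matrices $A\le B$ of any size, $f(A)\le f(B)$) and satisfies $f(1)=1$ and $f(x)=x f(x^{-1})$ for all $x>0$. For a positive definite $\pi$, let $\mathbb{L}_\pi[A]=\pi A$ and $\mathbb{R}_\pi[A]=A\pi$, and define the superoperator $\mathbb{J}_f|_\pi=\mathbb{R}_\pi\, f(\mathbb{L}_\pi\mathbb{R}_\pi^{-1})$, with inverse $\mathbb{J}_f^{-1}|_\pi=\mathbb{R}_\pi^{-1}\,(1/f)(\mathbb{L}_\pi\mathbb{R}_\pi^{-1})$. If $\pi\ge 0$ is singular, with support projection $P$, then $\mathbb{J}_f^{-1}|_\pi$ denotes the corresponding inverse on the operators $A=PAP$, extended by $0$ to their orthogonal complement. Put $$\mathcal{F}_{f,\pi}(A)=\operatorname{Tr}\big(A\,\mathbb{J}_f^{-1}|_\pi[A]\big),\qquad \chi^2_f(\rho\|\sigma)=\operatorname{Tr}\big((\rho-\sigma)\,\mathbb{J}_f^{-1}|_\rho[\rho-\sigma]\big),\qquad \|A\|_1=\operatorname{Tr}|A|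 .$$ **Theorem.** Let $\Phi:\mathrm{M}_n\to\mathrm{M}_m$ be a completely positive trace preserving linear map, let $f,f'$ be standard monotone functions with $f'(x)\le f(x)$ for all $x>0$, and let $\rho,\sigma\in\mathrm{M}_n$ be density matrices with $\rho$ of full rank. Let $\widetilde\Phi=\mathbb{J}_{f'}|_\rho\circ\Phi^\dagger\circ\mathbb{J}_f^{-1}|_{\Phi(\rho)}$ be the generalised Petz recovery map, where $\Phi^\dagger$ is the Hilbert–Schmidt adjoint of $\Phi$, and let $\Delta=\rho-\sigma$. Then $$\chi^2_{f'}(\rho\|\sigma)-\chi^2_f(\Phi(\rho)\|\Phi(\sigma))=\operatorname{Tr}\Big(\Delta\,\mathbb{J}_{f'}^{-1}|_\rho\big[(\mathrm{I}-\widetilde\Phi\Phi)(\Delta)\big]\Big)\;\ge\;\mathcal{F}_{f',\rho}\big((\mathrm{I}-\widetilde\Phi\Phi)(\Delta)\big)\;\ge\;\big\|(\mathrm{I}-\widetilde\Phi\Phi)(\Delta)\big\|_1^2 .$$ -/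

import Mathlib

open scoped ComplexOrder

section CompletePositivity

open scoped Matrix.Norms.L2Operator MatrixOrder CStarAlgebra

/-- `Φ` is a quantum channel: a completely positive and trace preserving linear map. -/
def IsCPTP {n m : Type*} [Fintype n] [DecidableEq n] [Fintype m] [DecidableEq m]
    (Φ : Matrix n n ℂ →ₗ[ℂ] Matrix m m ℂ) : Prop :=
  (∃ Ψ : Matrix n n ℂ →CP Matrix m m ℂ, Ψ.toLinearMap = Φ) ∧
    ∀ X : Matrix n n ℂ, (Φ X).trace = X.trace

end CompletePositivity

section TraceNorm

open scoped MatrixOrder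

/-- The trace norm `‖A‖₁ = Tr |A|`, where `|A| = √(A† A)`. -/
noncomputable def traceNorm {n : Type*} [Fintype n] [DecidableEq n] (A : Matrix n n ℂ) : ℝ :=
  (CFC.abs A).trace.re

end TraceNorm

/-- Standard monotone functions `f : (0, ∞) → (0, ∞)`. Only the values of `f` on `(0, ∞)` are
constrained (the spectrum of a positive definite matrix lies in `(0, ∞)`). -/
structure IsStandardMonotone (f : ℝ → ℝ) : Prop where
  pos : ∀ x : ℝ, 0 < x → 0 < f x
  matrix_monotone : ∀ (k : ℕ) (A B : Matrix (Fin k) (Fin k) ℂ), A.PosDef → B.PosDef →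
    (B - A).PosSemidef → (cfc f B - cfc f A).PosSemidef
  map_one : f 1 = 1
  symmetric : ∀ x : ℝ, 0 < x → f x = x * f x⁻¹

section Superoperators

variable {n m : Type*} [Fintype n] [DecidableEq n] [Fintype m] [DecidableEq m]

/-- The adjoint `Φ†` of a superoperator with respect to the Hilbert-Schmidt inner product
`⟨A, B⟩ = Tr (A† B)`, for which the matrix units are an orthonormal basis. -/
noncomputable def hsAdjoint (Φ : Matrix n n ℂ →ₗ[ℂ] Matrix m m ℂ) :
    Matrix m m ℂ →ₗ[ℂ] Matrix n n ℂ :=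
  Matrix.toLin (Matrix.stdBasis ℂ m m) (Matrix.stdBasis ℂ n n)
    (LinearMap.toMatrix (Matrix.stdBasis ℂ n n) (Matrix.stdBasis ℂ m m) Φ).conjTranspose

/-- The functional calculus `g(T)` of a superoperator `T` that is self-adjoint with respect to the
Hilbert-Schmidt inner product (computed in the orthonormal basis of matrix units). -/
noncomputable def superCalculus (g : ℝ → ℝ) (T : Matrix n n ℂ →ₗ[ℂ] Matrix n n ℂ) :
    Matrix n n ℂ →ₗ[ℂ] Matrix n n ℂ :=
  Matrix.toLin (Matrix.stdBasis ℂ n n) (Matrix.stdBasis ℂ n n)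
    (cfc g (LinearMap.toMatrix (Matrix.stdBasis ℂ n n) (Matrix.stdBasis ℂ n n) T))

/-- The inverse of a Hermitian matrix on its support, extended by `0` on its kernel (the function
`x ↦ x⁻¹` has the value `0` at `0`). It is the inverse of `π` if `π` is invertible. -/
noncomputable def supportInv (π : Matrix n n ℂ) : Matrix n n ℂ :=
  cfc (fun x : ℝ => x⁻¹) π

/-- The relative modular operator `𝕃_π ℝ_π⁻¹ : A ↦ π A π⁻¹`. -/
noncomputable def modularOp (π : Matrix n n ℂ) : Matrix n n ℂ →ₗ[ℂ] Matrix n n ℂ :=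
  LinearMap.mulLeft ℂ π ∘ₗ LinearMap.mulRight ℂ (supportInv π)

/-- The quantum Fisher operator `𝕁_f|_π = ℝ_π f(𝕃_π ℝ_π⁻¹)`. The function `f` lives on `(0, ∞)` and
is extended by `0`. -/
noncomputable def fisherOp (f : ℝ → ℝ) (π : Matrix n n ℂ) : Matrix n n ℂ →ₗ[ℂ] Matrix n n ℂ :=
  LinearMap.mulRight ℂ π ∘ₗ superCalculus ((Set.Ioi (0 : ℝ)).indicator f) (modularOp π)

/-- The inverse quantum Fisher operator `𝕁_f⁻¹|_π = ℝ_π⁻¹ (1/f)(𝕃_π ℝ_π⁻¹)`. For positive definite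
`π` it is the inverse of `fisherOp f π` (see `fisherOp_comp_fisherOpInv` and
`fisherOpInv_comp_fisherOp`); for a singular `π` it is the inverse on the operators
supported on the support of `π`, and `0` on their orthogonal complement. -/
noncomputable def fisherOpInv (f : ℝ → ℝ) (π : Matrix n n ℂ) :
    Matrix n n ℂ →ₗ[ℂ] Matrix n n ℂ :=
  LinearMap.mulRight ℂ (supportInv π) ∘ₗ
    superCalculus ((Set.Ioi (0 : ℝ)).indicator fun x => (f x)⁻¹) (modularOp π)

/-- The quantum Fisher scalar product `K_{f,π}(A, B) = Tr (A 𝕁_f⁻¹|_π [B])`. -/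
noncomputable def fisherProduct (f : ℝ → ℝ) (π A B : Matrix n n ℂ) : ℂ :=
  (A * fisherOpInv f π B).trace

/-- The quantum Fisher information `𝓕_{f,π}(A) = K_{f,π}(A, A)`. -/
noncomputable def fisherInfo (f : ℝ → ℝ) (π A : Matrix n n ℂ) : ℂ :=
  fisherProduct f π A A

/-- The divergence `χ²_f(ρ‖σ) = Tr ((ρ - σ) 𝕁_f⁻¹|_ρ [ρ - σ])`. -/
noncomputable def chiSq (f : ℝ → ℝ) (ρ σ : Matrix n n ℂ) : ℂ :=
  ((ρ - σ) * fisherOpInv f ρ (ρ - σ)).trace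

/-- The generalised Petz recovery map `𝕁_{f'}|_π ∘ Φ† ∘ 𝕁_f⁻¹|_{Φ(π)}`. -/
noncomputable def generalisedPetz (f' f : ℝ → ℝ) (π : Matrix n n ℂ)
    (Φ : Matrix n n ℂ →ₗ[ℂ] Matrix m m ℂ) : Matrix m m ℂ →ₗ[ℂ] Matrix n n ℂ :=
  fisherOp f' π ∘ₗ hsAdjoint Φ ∘ₗ fisherOpInv f (Φ π)

/-- The superoperator `𝕀 - Φ̃ ∘ Φ`, where `Φ̃` is the generalised Petz recovery map. -/
noncomputable def recoveryDefect (f' f : ℝ → ℝ) (π : Matrix n n ℂ)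
    (Φ : Matrix n n ℂ →ₗ[ℂ] Matrix m m ℂ) : Matrix n n ℂ →ₗ[ℂ] Matrix n n ℂ :=
  LinearMap.id - generalisedPetz f' f π Φ ∘ₗ Φ

end Superoperators

/-! The following facts check that `hsAdjoint` is the Hilbert-Schmidt adjoint and that
`fisherOpInv f π` is the two-sided inverse of `fisherOp f π` for positive definite `π`. -/
section SanityChecks

variable {n m : Type*} [Fintype n] [DecidableEq n] [Fintype m] [DecidableEq m]

theorem matrix_stdBasis_repr {n m : Type*} [Fintype n] [Fintype m] (A : Matrix n m ℂ) (p : n × m) :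
    (Matrix.stdBasis ℂ n m).repr A p = A p.1 p.2 := by
  simp [Matrix.stdBasis]

theorem hsAdjoint_apply (Φ : Matrix n n ℂ →ₗ[ℂ] Matrix m m ℂ) (B : Matrix m m ℂ) (i j : n) :
    hsAdjoint Φ B i j = ((Φ (Matrix.single i j 1)).conjTranspose * B).trace := by
  rw [← matrix_stdBasis_repr (hsAdjoint Φ B) (i, j), hsAdjoint, Matrix.repr_toLin]
  simp only [Matrix.mulVec, dotProduct, Matrix.conjTranspose_apply, LinearMap.toMatrix_apply,
    matrix_stdBasis_repr, Matrix.stdBasis_eq_single, Fintype.sum_prod_type, Matrix.trace, Matrix.diag,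
    Matrix.mul_apply]
  exact Finset.sum_comm

/-- The defining property of the Hilbert-Schmidt adjoint. -/
theorem trace_hsAdjoint (Φ : Matrix n n ℂ →ₗ[ℂ] Matrix m m ℂ) (A : Matrix n n ℂ)
    (B : Matrix m m ℂ) :
    (A.conjTranspose * hsAdjoint Φ B).trace = ((Φ A).conjTranspose * B).trace := by
  have h : (Φ A).conjTranspose * B = ∑ i, ∑ j, star (A i j) •
      ((Φ (Matrix.single i j 1)).conjTranspose * B) := by
    conv_lhs => rw [Matrix.matrix_eq_sum_single A]
    simp only [map_sum, Matrix.conjTranspose_sum, Finset.sum_mul]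
    refine Finset.sum_congr rfl fun i _ => Finset.sum_congr rfl fun j _ => ?_
    have : Matrix.single i j (A i j) = A i j • Matrix.single i j (1:ℂ) := by simp
    rw [this, map_smul, Matrix.conjTranspose_smul, Matrix.smul_mul]
  rw [h]
  simp only [Matrix.trace_sum, Matrix.trace_smul, ← hsAdjoint_apply]
  rw [Finset.sum_comm]
  simp [Matrix.trace, Matrix.mul_apply]

theorem toMatrix_mulLeft_mulRight (π σ : Matrix n n ℂ) :
    LinearMap.toMatrix (Matrix.stdBasis ℂ n n) (Matrix.stdBasis ℂ n n)
      (LinearMap.mulLeft ℂ π ∘ₗ LinearMap.mulRight ℂ σ) = Matrix.kroneckerMap (· * ·) π σ.transpose := by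
  ext ⟨i,j⟩ ⟨k,l⟩
  rw [LinearMap.toMatrix_apply, matrix_stdBasis_repr]
  simp [Matrix.stdBasis_eq_single, Matrix.mul_apply, Matrix.single_apply, ite_and]

theorem pos_of_mem_spectrum {π : Matrix n n ℂ} (hπ : π.PosDef) {x : ℝ} (hx : x ∈ spectrum ℝ π) : 0 < x := by
  rw [hπ.isHermitian.spectrum_real_eq_range_eigenvalues] at hx
  obtain ⟨i, rfl⟩ := hx
  exact hπ.eigenvalues_pos i

theorem supportInv_eq_inv {π : Matrix n n ℂ} (hπ : π.PosDef) : supportInv π = π⁻¹ := by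
  have h : supportInv π * π = 1 := by
    have hs : IsSelfAdjoint π := hπ.isHermitian
    have hf : (spectrum ℝ π).Finite := Matrix.finite_real_spectrum
    calc supportInv π * π = supportInv π * cfc (fun x : ℝ => x) π := by rw [cfc_id' ℝ π]
      _ = cfc (fun x : ℝ => x⁻¹ * x) π :=
          (cfc_mul _ _ _ (hf.continuousOn _) (hf.continuousOn _)).symm
      _ = cfc (fun _ : ℝ => 1) π :=
          cfc_congr fun x hx => inv_mul_cancel₀ (pos_of_mem_spectrum hπ hx).ne'
      _ = 1 := cfc_const_one ℝ π
  exact (Matrix.inv_eq_left_inv h).symm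

theorem superCalculus_mul {T : Matrix n n ℂ →ₗ[ℂ] Matrix n n ℂ}
    (hT : (LinearMap.toMatrix (Matrix.stdBasis ℂ n n) (Matrix.stdBasis ℂ n n) T).PosDef)
    {g h : ℝ → ℝ} (hgh : ∀ x, 0 < x → g x * h x = 1) :
    superCalculus g T ∘ₗ superCalculus h T = LinearMap.id := by
  have hs := hT.isHermitian.isSelfAdjoint
  have hf := Matrix.finite_real_spectrum
    (A := LinearMap.toMatrix (Matrix.stdBasis ℂ n n) (Matrix.stdBasis ℂ n n) T)
  rw [superCalculus, superCalculus, ← Matrix.toLin_mul,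
    ← cfc_mul _ _ _ (hf.continuousOn _) (hf.continuousOn _),
    cfc_congr (g := fun _ => (1:ℝ)) fun x hx => hgh x (pos_of_mem_spectrum hT hx), cfc_const_one ℝ _,
    Matrix.toLin_one]

theorem superCalculus_comm {T S : Matrix n n ℂ →ₗ[ℂ] Matrix n n ℂ}
    (hT : (LinearMap.toMatrix (Matrix.stdBasis ℂ n n) (Matrix.stdBasis ℂ n n) T).IsHermitian)
    (h : T ∘ₗ S = S ∘ₗ T) (g : ℝ → ℝ) : superCalculus g T ∘ₗ S = S ∘ₗ superCalculus g T := by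
  have := (hT.isSelfAdjoint.commute_cfc (b := LinearMap.toMatrix (Matrix.stdBasis ℂ n n) (Matrix.stdBasis ℂ n n) S)
    (by rw [Commute, SemiconjBy, ← LinearMap.toMatrix_comp _ (Matrix.stdBasis ℂ n n) _, h, LinearMap.toMatrix_comp _ (Matrix.stdBasis ℂ n n) _]) g).eq
  apply (LinearMap.toMatrix (Matrix.stdBasis ℂ n n) (Matrix.stdBasis ℂ n n)).injective
  rw [LinearMap.toMatrix_comp _ (Matrix.stdBasis ℂ n n) _ ,
    LinearMap.toMatrix_comp _ (Matrix.stdBasis ℂ n n) _, superCalculus, LinearMap.toMatrix_toLin]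
  exact this

theorem toMatrix_modularOp_posDef {π : Matrix n n ℂ} (hπ : π.PosDef) :
    (LinearMap.toMatrix (Matrix.stdBasis ℂ n n) (Matrix.stdBasis ℂ n n) (modularOp π)).PosDef := by
  rw [modularOp, toMatrix_mulLeft_mulRight, supportInv_eq_inv hπ]
  exact hπ.kronecker hπ.inv.transpose

theorem fisherOp_comp_fisherOpInv {f : ℝ → ℝ} (hf : ∀ x, 0 < x → 0 < f x) {π : Matrix n n ℂ}
    (hπ : π.PosDef) : fisherOp f π ∘ₗ fisherOpInv f π = LinearMap.id := by
  have hu : IsUnit π.det := (Matrix.isUnit_iff_isUnit_det π).1 hπ.isUnit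
  have hc : modularOp π ∘ₗ LinearMap.mulRight ℂ (supportInv π) =
      LinearMap.mulRight ℂ (supportInv π) ∘ₗ modularOp π := by
    ext1 A; simp [modularOp, mul_assoc]
  have h1 := superCalculus_comm (toMatrix_modularOp_posDef hπ).isHermitian hc ((Set.Ioi (0 : ℝ)).indicator f)
  have h2 : superCalculus ((Set.Ioi (0 : ℝ)).indicator f) (modularOp π) ∘ₗ
      superCalculus ((Set.Ioi (0 : ℝ)).indicator fun x => (f x)⁻¹) (modularOp π) = LinearMap.id :=
    superCalculus_mul (toMatrix_modularOp_posDef hπ) fun x hx => by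
      simp [Set.indicator, hx, (hf x hx).ne']
  have h3 : LinearMap.mulRight ℂ π ∘ₗ LinearMap.mulRight ℂ (supportInv π) = LinearMap.id := by
    ext1 A; simp [supportInv_eq_inv hπ, mul_assoc, Matrix.nonsing_inv_mul _ hu]
  rw [fisherOp, fisherOpInv, LinearMap.comp_assoc, ← LinearMap.comp_assoc _ _ (superCalculus _ _), h1,
    LinearMap.comp_assoc, h2, LinearMap.comp_id, h3]

theorem fisherOpInv_comp_fisherOp {f : ℝ → ℝ} (hf : ∀ x, 0 < x → 0 < f x) {π : Matrix n n ℂ}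
    (hπ : π.PosDef) : fisherOpInv f π ∘ₗ fisherOp f π = LinearMap.id :=
  mul_eq_one_comm.1 (fisherOp_comp_fisherOpInv hf hπ)

end SanityChecks

/-! ### Two-positivity of channels -/

section TwoPositivity

open scoped Matrix.Norms.L2Operator MatrixOrder CStarAlgebra

/-! Write `E = Φ Δ`, `B = 𝕁_f⁻¹|_{Φ(ρ)} E`, `Y = Φ† B`, `Z = 𝕁_{f'}|_ρ Y`, so that the recovery
defect of `Δ` is `Δ - Z`. For the scalar product `K` of `f'` at `ρ`, `K(Δ, Z) = Tr(Δ Y) = Tr(E B)`,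
which is the divergence after the channel; this is the equality. The gap in the first inequality is
`K(Z, Δ - Z) = Tr(E B) - Tr(Y 𝕁_{f'}|_ρ Y)`.

The gap is nonnegative because `𝕁_{f'}|_ρ ≤ 𝕁_f|_ρ` and, on the support of `Φ ρ`, `Φ 𝕁_f|_ρ Φ† ≤
𝕁_f|_{Φ(ρ)}` (`IsStandardMonotone.sum_fisherSymbol_hsAdjoint_le`). The latter is Petz's argument: `V
= ℝ_ρ^{1/2} Φ† ℝ_{Φ(ρ)}^{-1/2}` satisfies `V†V ≤ 1` and `V† a V ≤ d`, where `a`, `d` are the modular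
operators. Both bounds are instances of the Schwarz inequality `trace_hsAdjoint_schwarz`. Operator
Jensen (`IsStandardMonotone.sum_le_sum_of_contraction`) then gives `V† f(a) V ≤ f(d)`.

The same Jensen inequality, for a map out of a one-dimensional space, gives `⟨S, 𝕁_{f'}|_ρ S⟩ ≤ 1`
for Hermitian unitaries `S`. Cauchy-Schwarz with the sign of the Hermitian matrix `Δ - Z` as `S`
yields the trace norm bound.

In an eigenbasis of the state every superoperator here acts by entrywise multiplication, so all
operator inequalities become inequalities of weighted sums of squares. -/

theorem exists_eq_star_mul_self_of_nonneg {A : Type*} [NonUnitalCStarAlgebra A] [PartialOrder A]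
    [StarOrderedRing A] {a : A} (ha : 0 ≤ a) : ∃ b : A, a = star b * b :=
  CStarAlgebra.nonneg_iff_eq_star_mul_self.mp ha

/-- Two-positivity of a completely positive map, with the positive `2 × 2` block matrix
`Φ ([P, Q]ᴴ [P, Q])` written as a sum of squares. -/
theorem exists_block_decomposition {n m : Type*} [Fintype n] [DecidableEq n] [Fintype m]
    [DecidableEq m] {Φ : Matrix n n ℂ →ₗ[ℂ] Matrix m m ℂ} (hΦ : IsCPTP Φ) (P Q : Matrix n n ℂ) :
    ∃ a b c d : Matrix m m ℂ,
      Φ (P.conjTranspose * P) = a.conjTranspose * a + b.conjTranspose * b ∧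
      Φ (P.conjTranspose * Q) = a.conjTranspose * c + b.conjTranspose * d ∧
      Φ (Q.conjTranspose * P) = c.conjTranspose * a + d.conjTranspose * b ∧
      Φ (Q.conjTranspose * Q) = c.conjTranspose * c + d.conjTranspose * d := by
  obtain ⟨⟨Ψ, rfl⟩, -⟩ := hΦ
  let G : CStarMatrix (Fin 2) (Fin 2) (Matrix n n ℂ) := CStarMatrix.ofMatrix !![P, Q; 0, 0]
  have h := Ψ.map_cstarMatrix_nonneg' 2 (star G * G) (star_mul_self_nonneg G)
  obtain ⟨H, hH⟩ := by exact exists_eq_star_mul_self_of_nonneg h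
  have key : ∀ i j, Ψ.toLinearMap ((star G * G) i j) = (star H * H) i j := fun i j =>
    congrFun (congrFun hH i) j
  refine ⟨H 0 0, H 1 0, H 0 1, H 1 1, ?_, ?_, ?_, ?_⟩
  · simpa [G, CStarMatrix.mul_apply, CStarMatrix.star_apply, Fin.sum_univ_two, Matrix.star_eq_conjTranspose] using key 0 0
  · simpa [G, CStarMatrix.mul_apply, CStarMatrix.star_apply, Fin.sum_univ_two, Matrix.star_eq_conjTranspose] using key 0 1
  · simpa [G, CStarMatrix.mul_apply, CStarMatrix.star_apply, Fin.sum_univ_two, Matrix.star_eq_conjTranspose] using key 1 0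
  · simpa [G, CStarMatrix.mul_apply, CStarMatrix.star_apply, Fin.sum_univ_two, Matrix.star_eq_conjTranspose] using key 1 1

end TwoPositivity

/-! ### Channels, their adjoints and the Schwarz inequality -/

section Channels

open Matrix

variable {n m : Type*} [Fintype n] [DecidableEq n] [Fintype m] [DecidableEq m]

/-- The two off-diagonal blocks of a sum of squares are adjoint to each other; take the blocks `1`
and `A`. -/
theorem IsCPTP.map_conjTranspose {Φ : Matrix n n ℂ →ₗ[ℂ] Matrix m m ℂ} (hΦ : IsCPTP Φ)
    (A : Matrix n n ℂ) : Φ Aᴴ = (Φ A)ᴴ := by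
  obtain ⟨a, b, c, d, -, h1, h2, -⟩ := exists_block_decomposition hΦ 1 A
  simp only [conjTranspose_one, one_mul, mul_one] at h1 h2
  rw [h1, h2]
  simp

theorem IsCPTP.map_posSemidef {Φ : Matrix n n ℂ →ₗ[ℂ] Matrix m m ℂ} (hΦ : IsCPTP Φ)
    {A : Matrix n n ℂ} (hA : A.PosSemidef) : (Φ A).PosSemidef := by
  obtain ⟨B, rfl⟩ : ∃ B : Matrix n n ℂ, A = Bᴴ * B := by
    open scoped MatrixOrder in
    exact CStarAlgebra.nonneg_iff_eq_star_mul_self.mp hA.nonneg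
  obtain ⟨a, b, c, d, h, -⟩ := exists_block_decomposition hΦ B 1
  rw [h]
  exact (posSemidef_conjTranspose_mul_self a).add (posSemidef_conjTranspose_mul_self b)

theorem hsAdjoint_conjTranspose {Φ : Matrix n n ℂ →ₗ[ℂ] Matrix m m ℂ} (hΦ : IsCPTP Φ)
    (B : Matrix m m ℂ) : hsAdjoint Φ Bᴴ = (hsAdjoint Φ B)ᴴ := by
  ext i j
  rw [conjTranspose_apply, hsAdjoint_apply, hsAdjoint_apply, ← hΦ.map_conjTranspose,
    ← hΦ.map_conjTranspose, ← trace_conjTranspose, conjTranspose_mul, trace_mul_comm,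
    ← hΦ.map_conjTranspose]
  simp

theorem trace_mul_hsAdjoint {Φ : Matrix n n ℂ →ₗ[ℂ] Matrix m m ℂ} (hΦ : IsCPTP Φ)
    (A : Matrix n n ℂ) (B : Matrix m m ℂ) : (A * hsAdjoint Φ B).trace = (Φ A * B).trace := by
  have := trace_hsAdjoint Φ Aᴴ B
  rwa [hΦ.map_conjTranspose, conjTranspose_conjTranspose, conjTranspose_conjTranspose] at this

/-- The Kadison-Schwarz inequality for the adjoint of a channel, in the state `ρ`. -/
theorem trace_hsAdjoint_schwarz {Φ : Matrix n n ℂ →ₗ[ℂ] Matrix m m ℂ} (hΦ : IsCPTP Φ)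
    {ρ : Matrix n n ℂ} (hρ : ρ.PosSemidef) (C : Matrix m m ℂ) :
    (hsAdjoint Φ C * ρ * (hsAdjoint Φ C)ᴴ).trace ≤ (C * Φ ρ * Cᴴ).trace := by
  obtain ⟨R, rfl⟩ : ∃ B : Matrix n n ℂ, ρ = Bᴴ * B := by
    open scoped MatrixOrder in
    exact CStarAlgebra.nonneg_iff_eq_star_mul_self.mp hρ.nonneg
  set Y := hsAdjoint Φ C with hY
  -- With `ρ = R†R` the blocks are the images of `YρY†`, `Yρ`, `ρY†`, `ρ`. Sandwiching this block
  -- matrix with the row `(1, -C)` gives the positive matrix in `hpos`. By duality both cross terms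
  -- have the same trace as the first term, so only one copy of `Tr YρY†` remains, with a minus
  -- sign.
  obtain ⟨a, b, c, d, h1, h2, h3, h4⟩ := exists_block_decomposition hΦ (R * Yᴴ) R
  have hpos : 0 ≤ ((a - c * Cᴴ)ᴴ * (a - c * Cᴴ) + (b - d * Cᴴ)ᴴ * (b - d * Cᴴ)).trace :=
    ((posSemidef_conjTranspose_mul_self _).add (posSemidef_conjTranspose_mul_self _)).trace_nonneg
  have e : (a - c * Cᴴ)ᴴ * (a - c * Cᴴ) + (b - d * Cᴴ)ᴴ * (b - d * Cᴴ) =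
      Φ ((R * Yᴴ)ᴴ * (R * Yᴴ)) - Φ ((R * Yᴴ)ᴴ * R) * Cᴴ - C * Φ (Rᴴ * (R * Yᴴ)) +
        C * Φ (Rᴴ * R) * Cᴴ := by
    rw [h1, h2, h3, h4]
    simp only [conjTranspose_sub, conjTranspose_mul, conjTranspose_conjTranspose]
    noncomm_ring
  have t1 : (Φ ((R * Yᴴ)ᴴ * (R * Yᴴ))).trace = (Y * (Rᴴ * R) * Yᴴ).trace := by
    rw [hΦ.2]; simp [Matrix.mul_assoc]
  have t2 : (Φ ((R * Yᴴ)ᴴ * R) * Cᴴ).trace = (Y * (Rᴴ * R) * Yᴴ).trace := by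
    rw [← trace_mul_hsAdjoint hΦ, hsAdjoint_conjTranspose hΦ, ← hY]; simp [Matrix.mul_assoc]
  have t3 : (C * Φ (Rᴴ * (R * Yᴴ))).trace = (Y * (Rᴴ * R) * Yᴴ).trace := by
    rw [trace_mul_comm, ← trace_mul_hsAdjoint hΦ, ← hY, trace_mul_comm]; simp [Matrix.mul_assoc]
  rw [e, trace_add, trace_sub, trace_sub, t1, t2, t3, sub_self, zero_sub, neg_add_eq_sub,
    sub_nonneg] at hpos
  exact hpos

end Channels

/-! ### Functional calculus of unitarily diagonalised matrices -/

section FunctionalCalculus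

open Matrix Polynomial

theorem exists_real_polynomial_eqOn {s : Set ℝ} (hs : s.Finite) (g : ℝ → ℝ) :
    ∃ p : ℝ[X], ∀ x ∈ s, p.eval x = g x :=
  ⟨Lagrange.interpolate hs.toFinset id g, fun _ hx =>
    Lagrange.eval_interpolate_at_node (v := id) g Function.injective_id.injOn (hs.mem_toFinset.mpr hx)⟩

variable {τ : Type*} [Fintype τ] [DecidableEq τ]

theorem aeval_conj_diagonal {U : Matrix τ τ ℂ} (hU : Uᴴ * U = 1) (a : τ → ℝ) (p : ℝ[X]) :
    aeval (U * diagonal (fun i => (a i : ℂ)) * Uᴴ) p =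
      U * diagonal (fun i => ((p.eval (a i) : ℝ) : ℂ)) * Uᴴ := by
  induction p using Polynomial.induction_on with
  | C r =>
    have : diagonal (fun _ : τ => (r : ℂ)) = (r : ℂ) • (1 : Matrix τ τ ℂ) := by
      rw [smul_one_eq_diagonal]
    simp [this, mul_eq_one_comm.mp hU, Algebra.algebraMap_eq_smul_one]
  | add p q hp hq =>
    simp only [map_add, hp, hq, eval_add, Complex.ofReal_add, ← diagonal_add, mul_add, add_mul]
  | monomial k r h =>
    rw [pow_succ, ← mul_assoc, map_mul, h, aeval_X]
    calc _ = U * diagonal (fun i => (((C r * X ^ k : ℝ[X]).eval (a i) : ℝ) : ℂ)) * (Uᴴ * U) *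
          diagonal (fun i => (a i : ℂ)) * Uᴴ := by simp only [mul_assoc]
      _ = _ := by
        rw [hU, mul_one, mul_assoc U, diagonal_mul_diagonal]
        simp

theorem cfc_conj_diagonal {U : Matrix τ τ ℂ} (hU : Uᴴ * U = 1) (a : τ → ℝ) (g : ℝ → ℝ) :
    cfc g (U * diagonal (fun i => (a i : ℂ)) * Uᴴ) =
      U * diagonal (fun i => (g (a i) : ℂ)) * Uᴴ := by
  set X := U * diagonal (fun i => (a i : ℂ)) * Uᴴ with hX
  have hs : IsSelfAdjoint X := by
    rw [isSelfAdjoint_iff, star_eq_conjTranspose, hX]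
    simp [conjTranspose_mul, diagonal_conjTranspose, mul_assoc, Pi.star_def]
  -- Interpolating on the spectrum and on the entries `a` together avoids identifying the two sets.
  -- Both are finite, so `g` need not be continuous.
  obtain ⟨p, hp⟩ := exists_real_polynomial_eqOn
    ((Matrix.finite_real_spectrum (A := X)).union (Set.finite_range a)) g
  rw [← cfc_congr (f := p.eval) fun x hx => hp x (Or.inl hx), cfc_polynomial p X hs,
    hX, aeval_conj_diagonal hU]
  simp [hp]

end FunctionalCalculus

/-! ### Operator monotonicity and operator Jensen inequalities -/

section OperatorInequalities

open Matrix

theorem star_dotProduct_conjTranspose_mul_diagonal_mul_mulVec {ι τ : Type*} [Fintype ι]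
    [DecidableEq ι] [Fintype τ] (U : Matrix ι τ ℂ) (q : ι → ℝ) (y : τ → ℂ) :
    star y ⬝ᵥ ((Uᴴ * diagonal (fun i => (q i : ℂ)) * U) *ᵥ y) =
      ((∑ i, q i * ‖(U *ᵥ y) i‖ ^ 2 : ℝ) : ℂ) := by
  rw [← mulVec_mulVec, ← mulVec_mulVec, dotProduct_mulVec, ← star_mulVec]
  simp only [dotProduct, mulVec_diagonal, Complex.ofReal_sum, Pi.star_apply]
  refine Finset.sum_congr rfl fun i _ => ?_
  rw [Complex.ofReal_mul, Complex.ofReal_pow, ← Complex.conj_mul', RCLike.star_def]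
  ring

/-- This translates the Loewner order into weighted sums of squares, the form in which all later
inequalities are stated. -/
theorem posSemidef_diagonal_sub_iff {τ : Type*} [Fintype τ] [DecidableEq τ] (U : Matrix τ τ ℂ)
    (a b : τ → ℝ) :
    (diagonal (fun i => (b i : ℂ)) - Uᴴ * diagonal (fun i => (a i : ℂ)) * U).PosSemidef ↔
      ∀ y : τ → ℂ, ∑ i, a i * ‖(U *ᵥ y) i‖ ^ 2 ≤ ∑ i, b i * ‖y i‖ ^ 2 := by
  have hd : ∀ c : τ → ℝ, (diagonal fun i => (c i : ℂ)).IsHermitian := fun c => by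
    simp [IsHermitian, diagonal_conjTranspose, Pi.star_def]
  have h1 : ∀ y : τ → ℂ, star y ⬝ᵥ (diagonal (fun i => (b i : ℂ)) *ᵥ y) =
      ((∑ i, b i * ‖y i‖ ^ 2 : ℝ) : ℂ) := fun y => by
    simpa using star_dotProduct_conjTranspose_mul_diagonal_mul_mulVec (1 : Matrix τ τ ℂ) b y
  simp only [posSemidef_iff_dotProduct_mulVec, sub_mulVec, dotProduct_sub, h1,
    star_dotProduct_conjTranspose_mul_diagonal_mul_mulVec, sub_nonneg, Complex.real_le_real]
  exact and_iff_right ((hd b).sub (isHermitian_conjTranspose_mul_mul U (hd a)))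

theorem IsStandardMonotone.sum_le_sum_fin {f : ℝ → ℝ} (hf : IsStandardMonotone f) {k : ℕ}
    {U : Matrix (Fin k) (Fin k) ℂ} (hU : Uᴴ * U = 1) {a b : Fin k → ℝ} (ha : ∀ i, 0 < a i)
    (hb : ∀ i, 0 < b i)
    (h : ∀ y : Fin k → ℂ, ∑ i, a i * ‖(U *ᵥ y) i‖ ^ 2 ≤ ∑ i, b i * ‖y i‖ ^ 2) (y : Fin k → ℂ) :
    ∑ i, f (a i) * ‖(U *ᵥ y) i‖ ^ 2 ≤ ∑ i, f (b i) * ‖y i‖ ^ 2 := by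
  have hU' : U * Uᴴ = 1 := mul_eq_one_comm.mp hU
  have hpos : ∀ c : Fin k → ℝ, (∀ i, 0 < c i) → (diagonal fun i => (c i : ℂ)).PosDef :=
    fun c hc => PosDef.diagonal fun i => by simpa using hc i
  have hA : (Uᴴ * diagonal (fun i => (a i : ℂ)) * U).PosDef :=
    (hpos a ha).conjTranspose_mul_mul_same
      (mulVec_injective_of_isUnit (IsUnit.of_mul_eq_one _ hU'))
  have e1 := cfc_conj_diagonal (U := Uᴴ) (by simpa using hU') a f
  have e2 := cfc_conj_diagonal (U := (1 : Matrix (Fin k) (Fin k) ℂ)) (by simp) b f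
  simp only [conjTranspose_conjTranspose, conjTranspose_one, one_mul, mul_one] at e1 e2
  have := hf.matrix_monotone k _ _ hA (hpos b hb) ((posSemidef_diagonal_sub_iff U a b).mpr h)
  rw [e1, e2] at this
  exact (posSemidef_diagonal_sub_iff U _ _).mp this y

/-- Matrix monotonicity, for spectrally decomposed matrices over an arbitrary index type. -/
theorem IsStandardMonotone.sum_le_sum {f : ℝ → ℝ} (hf : IsStandardMonotone f) {τ : Type*}
    [Fintype τ] [DecidableEq τ] {U : Matrix τ τ ℂ} (hU : Uᴴ * U = 1) {a b : τ → ℝ}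
    (ha : ∀ i, 0 < a i) (hb : ∀ i, 0 < b i)
    (h : ∀ y : τ → ℂ, ∑ i, a i * ‖(U *ᵥ y) i‖ ^ 2 ≤ ∑ i, b i * ‖y i‖ ^ 2) (y : τ → ℂ) :
    ∑ i, f (a i) * ‖(U *ᵥ y) i‖ ^ 2 ≤ ∑ i, f (b i) * ‖y i‖ ^ 2 := by
  let e := (Fintype.equivFin τ).symm
  have hmv : ∀ (z : τ → ℂ) i, (U.submatrix e e *ᵥ (z ∘ e)) i = (U *ᵥ z) (e i) := fun z i => by
    simp only [mulVec, dotProduct, submatrix_apply, Function.comp]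
    exact e.sum_comp fun j => U (e i) j * z j
  have := hf.sum_le_sum_fin (U := U.submatrix e e) (a := a ∘ e) (b := b ∘ e)
    (by rw [conjTranspose_submatrix, submatrix_mul_equiv, hU, submatrix_one_equiv])
    (fun i => ha _) (fun i => hb _) (fun z => by
      obtain ⟨w, rfl⟩ : ∃ w : τ → ℂ, z = w ∘ e := ⟨z ∘ e.symm, by ext; simp⟩
      simp only [hmv, Function.comp]
      rw [e.sum_comp fun i => a i * ‖(U *ᵥ w) i‖ ^ 2, e.sum_comp fun i => b i * ‖w i‖ ^ 2]
      exact h w) (y ∘ e)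
  simp only [hmv, Function.comp] at this
  rwa [e.sum_comp fun i => f (a i) * ‖(U *ᵥ y) i‖ ^ 2,
    e.sum_comp fun i => f (b i) * ‖y i‖ ^ 2] at this

theorem IsStandardMonotone.monotoneOn {f : ℝ → ℝ} (hf : IsStandardMonotone f) {x y : ℝ}
    (hx : 0 < x) (hxy : x ≤ y) : f x ≤ f y := by
  have := hf.sum_le_sum (τ := Unit) (U := 1) (by simp) (a := fun _ => x) (b := fun _ => y)
    (fun _ => hx) (fun _ => hx.trans_le hxy)
    (fun z => by simpa using mul_le_mul_of_nonneg_right hxy (sq_nonneg _)) (fun _ => 1)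
  simpa using this

/-- By symmetry `f x / x = f x⁻¹`, which is decreasing in `x`. This lets a factor `1 + η` be pulled
out of `f`, so the limits `η → 0` below need no continuity of `f`. -/
theorem IsStandardMonotone.map_mul_le {f : ℝ → ℝ} (hf : IsStandardMonotone f) {x t : ℝ}
    (hx : 0 < x) (ht : 1 ≤ t) : f (t * x) ≤ t * f x := by
  have ht0 : 0 < t := one_pos.trans_le ht
  have htx : 0 < t * x := mul_pos ht0 hx
  rw [hf.symmetric _ htx, hf.symmetric _ hx, ← mul_assoc]
  exact mul_le_mul_of_nonneg_left (hf.monotoneOn (inv_pos.mpr htx)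
    (inv_anti₀ hx (le_mul_of_one_le_left hx.le ht))) htx.le

theorem norm_add_sq_le_weighted (u v : ℂ) {η : ℝ} (hη : 0 < η) :
    ‖u + v‖ ^ 2 ≤ (1 + η⁻¹) * ‖u‖ ^ 2 + (1 + η) * ‖v‖ ^ 2 := by
  have h1 : ‖u + v‖ ^ 2 ≤ (‖u‖ + ‖v‖) ^ 2 := by gcongr; exact norm_add_le u v
  have h2 : 0 ≤ η⁻¹ * (‖u‖ - η * ‖v‖) ^ 2 := by positivity
  have h3 : η⁻¹ * (‖u‖ - η * ‖v‖) ^ 2 = η⁻¹ * ‖u‖ ^ 2 - 2 * ‖u‖ * ‖v‖ + η * ‖v‖ ^ 2 := by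
    field_simp
    ring
  nlinarith

theorem le_of_forall_le_one_add_mul {s t : ℝ} (h : ∀ η : ℝ, 0 < η → s ≤ (1 + η) * t) : s ≤ t := by
  have hc : Filter.Tendsto (fun η : ℝ => (1 + η) * t) (nhdsWithin 0 (Set.Ioi 0)) (nhds t) := by
    have : Continuous fun η : ℝ => (1 + η) * t := by fun_prop
    simpa using (this.tendsto 0).mono_left nhdsWithin_le_nhds
  exact ge_of_tendsto hc (Filter.eventually_of_mem self_mem_nhdsWithin h)

/-- The operator Jensen inequality for isometries: if `W† a W ≤ d` for positive diagonal `a`, `d`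
and an isometry `W`, then `W† f(a) W ≤ f(d)`. -/
theorem IsStandardMonotone.sum_le_sum_of_isometry {f : ℝ → ℝ} (hf : IsStandardMonotone f)
    {ι κ : Type*} [Fintype ι] [DecidableEq ι] [Fintype κ] [DecidableEq κ] {W : Matrix ι κ ℂ}
    (hW : Wᴴ * W = 1) {a : ι → ℝ} {d : κ → ℝ} (ha : ∀ i, 0 < a i) (hd : ∀ k, 0 < d k)
    (h : ∀ x : κ → ℂ, ∑ i, a i * ‖(W *ᵥ x) i‖ ^ 2 ≤ ∑ k, d k * ‖x k‖ ^ 2) (x : κ → ℂ) :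
    ∑ i, f (a i) * ‖(W *ᵥ x) i‖ ^ 2 ≤ ∑ k, f (d k) * ‖x k‖ ^ 2 := by
  -- A unitary dilation of the isometry: it sends `(0, z)` to `(W z, 0)`.
  let U : Matrix (ι ⊕ κ) (ι ⊕ κ) ℂ := fromBlocks (1 - W * Wᴴ) W Wᴴ 0
  have hWW : W * Wᴴ * (W * Wᴴ) = W * Wᴴ := by
    rw [Matrix.mul_assoc, ← Matrix.mul_assoc Wᴴ, hW, Matrix.one_mul]
  have hU : Uᴴ * U = 1 := by
    simp only [U, fromBlocks_conjTranspose, fromBlocks_multiply, conjTranspose_sub,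
      conjTranspose_mul, conjTranspose_conjTranspose, conjTranspose_one, conjTranspose_zero]
    rw [← fromBlocks_one]
    congr 1
    · rw [Matrix.mul_sub, Matrix.sub_mul, Matrix.sub_mul, hWW]; simp
    · rw [Matrix.sub_mul, Matrix.mul_assoc, hW]; simp
    · rw [Matrix.mul_sub, ← Matrix.mul_assoc, hW]; simp
    · simp [hW]
  have hUnorm : ∀ y : ι ⊕ κ → ℂ, ∑ i, ‖(U *ᵥ y) i‖ ^ 2 = ∑ i, ‖y i‖ ^ 2 := fun y => by
    have h1 := star_dotProduct_conjTranspose_mul_diagonal_mul_mulVec U (fun _ => 1) y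
    have h2 := star_dotProduct_conjTranspose_mul_diagonal_mul_mulVec
      (1 : Matrix (ι ⊕ κ) (ι ⊕ κ) ℂ) (fun _ => 1) y
    simp only [Complex.ofReal_one, diagonal_one, mul_one, one_mul, one_mulVec,
      conjTranspose_one, hU] at h1 h2
    exact_mod_cast h1.symm.trans h2
  obtain ⟨M, hM0, hM⟩ : ∃ M : ℝ, 0 < M ∧ ∀ i, Sum.elim a (fun _ : κ => (1 : ℝ)) i ≤ M := by
    refine ⟨∑ i, a i + 1, ?_, ?_⟩
    · have := Finset.sum_nonneg fun i (_ : i ∈ Finset.univ) => (ha i).le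
      linarith
    · rintro (i | k)
      · have := Finset.single_le_sum (f := a) (fun i _ => (ha i).le) (Finset.mem_univ i)
        simp only [Sum.elim_inl]; linarith
      · have := Finset.sum_nonneg fun i (_ : i ∈ Finset.univ) => (ha i).le
        simp only [Sum.elim_inr]; linarith
  have ha' : ∀ i, 0 < Sum.elim a (fun _ : κ => (1 : ℝ)) i := by
    rintro (i | k) <;> simp [ha]
  have hUinr : ∀ z : κ → ℂ, U *ᵥ Sum.elim 0 z = Sum.elim (W *ᵥ z) 0 := fun z => by
    simp [U, fromBlocks_mulVec]
  have key : ∀ η : ℝ, 0 < η → ∑ i, f (a i) * ‖(W *ᵥ x) i‖ ^ 2 ≤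
      (1 + η) * ∑ k, f (d k) * ‖x k‖ ^ 2 := by
    intro η hη
    -- The dilated form need not be block diagonal. Splitting `y = (u, 0) + (0, v)` with weights `1
    -- + η⁻¹` and `1 + η` dominates it by a block diagonal one. The first block is large but
    -- harmless, since the result is evaluated at `(0, x)`; the weight `1` on `κ` is an arbitrary
    -- positive filler.
    have := hf.sum_le_sum hU (a := Sum.elim a fun _ => 1)
      (b := Sum.elim (fun _ => (1 + η⁻¹) * M) (fun k => (1 + η) * d k)) ha'
      (by
        rintro (i | k)
        · simp only [Sum.elim_inl]; positivity
        · have := hd k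
          simp only [Sum.elim_inr]; positivity)
      (fun y => by
        obtain ⟨u, v, rfl⟩ : ∃ u v, y = Sum.elim u v :=
          ⟨y ∘ Sum.inl, y ∘ Sum.inr, (Sum.elim_comp_inl_inr y).symm⟩
        have hsplit : (Sum.elim u v : ι ⊕ κ → ℂ) = Sum.elim u (0 : κ → ℂ) + Sum.elim (0 : ι → ℂ) v := by
          ext (i | k) <;> simp
        calc ∑ i, Sum.elim a (fun _ => (1 : ℝ)) i * ‖(U *ᵥ Sum.elim u v) i‖ ^ 2
          _ ≤ ∑ i, Sum.elim a (fun _ => (1 : ℝ)) i * ((1 + η⁻¹) * ‖(U *ᵥ Sum.elim u 0) i‖ ^ 2 +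
                (1 + η) * ‖(U *ᵥ Sum.elim 0 v) i‖ ^ 2) := by
              refine Finset.sum_le_sum fun i _ => mul_le_mul_of_nonneg_left ?_ (ha' i).le
              rw [hsplit, mulVec_add]
              exact norm_add_sq_le_weighted _ _ hη
          _ = (1 + η⁻¹) * (∑ i, Sum.elim a (fun _ => (1 : ℝ)) i * ‖(U *ᵥ Sum.elim u 0) i‖ ^ 2) +
                (1 + η) * ∑ i, a i * ‖(W *ᵥ v) i‖ ^ 2 := by
              have e : ∀ s p q : ℝ, s * ((1 + η⁻¹) * p + (1 + η) * q) =
                  (1 + η⁻¹) * (s * p) + (1 + η) * (s * q) := fun s p q => by ring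
              simp only [e, Finset.sum_add_distrib, ← Finset.mul_sum]
              rw [hUinr v, Fintype.sum_sum_type fun i =>
                Sum.elim a (fun _ => (1 : ℝ)) i * ‖Sum.elim (W *ᵥ v) (0 : κ → ℂ) i‖ ^ 2]
              simp
          _ ≤ (1 + η⁻¹) * (M * ∑ i, ‖(U *ᵥ Sum.elim u 0) i‖ ^ 2) +
                (1 + η) * ∑ k, d k * ‖v k‖ ^ 2 := by
              gcongr
              · rw [Finset.mul_sum]
                exact Finset.sum_le_sum fun i _ => mul_le_mul_of_nonneg_right (hM i) (sq_nonneg _)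
              · exact h v
          _ = _ := by
              rw [hUnorm]
              simp [Fintype.sum_sum_type, Finset.mul_sum, mul_assoc])
      (Sum.elim 0 x)
    rw [hUinr] at this
    simp only [Fintype.sum_sum_type, Sum.elim_inl, Sum.elim_inr, Pi.zero_apply, norm_zero, ne_eq,
      OfNat.ofNat_ne_zero, not_false_eq_true, zero_pow, mul_zero, Finset.sum_const_zero, add_zero,
      zero_add] at this
    refine this.trans ?_
    rw [Finset.mul_sum]
    refine Finset.sum_le_sum fun k _ => ?_
    rw [← mul_assoc]
    exact mul_le_mul_of_nonneg_right (hf.map_mul_le (hd k) (by linarith)) (sq_nonneg _)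
  exact le_of_forall_le_one_add_mul key

/-- The operator Jensen inequality for contractions: if `V† V ≤ 1` and `V† a V ≤ d` for positive
diagonal `a`, `d`, then `V† f(a) V ≤ f(d)`. -/
theorem IsStandardMonotone.sum_le_sum_of_contraction {f : ℝ → ℝ} (hf : IsStandardMonotone f)
    {ι κ : Type*} [Fintype ι] [Fintype κ] (V : (κ → ℂ) →ₗ[ℂ] (ι → ℂ)) {a : ι → ℝ} {d : κ → ℝ}
    (ha : ∀ i, 0 < a i) (hd : ∀ k, 0 < d k)
    (hV : ∀ x, ∑ i, ‖V x i‖ ^ 2 ≤ ∑ k, ‖x k‖ ^ 2)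
    (h : ∀ x, ∑ i, a i * ‖V x i‖ ^ 2 ≤ ∑ k, d k * ‖x k‖ ^ 2) (x : κ → ℂ) :
    ∑ i, f (a i) * ‖V x i‖ ^ 2 ≤ ∑ k, f (d k) * ‖x k‖ ^ 2 := by
  classical
  obtain ⟨T, rfl⟩ : ∃ T : Matrix ι κ ℂ, V = T.toLin' := ⟨LinearMap.toMatrix' V, by simp⟩
  simp only [toLin'_apply] at *
  have hTT : ∀ y, star y ⬝ᵥ ((Tᴴ * T) *ᵥ y) = ((∑ i, ‖(T *ᵥ y) i‖ ^ 2 : ℝ) : ℂ) := fun y => by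
    simpa using star_dotProduct_conjTranspose_mul_diagonal_mul_mulVec T (fun _ => 1) y
  have h11 : ∀ y : κ → ℂ, star y ⬝ᵥ y = ((∑ i, ‖y i‖ ^ 2 : ℝ) : ℂ) := fun y => by
    simpa using star_dotProduct_conjTranspose_mul_diagonal_mul_mulVec (1 : Matrix κ κ ℂ)
      (fun _ => 1) y
  have hpos : (1 - Tᴴ * T).PosSemidef := by
    refine PosSemidef.of_dotProduct_mulVec_nonneg
      (isHermitian_one.sub (isHermitian_conjTranspose_mul_self T)) fun y => ?_
    rw [sub_mulVec, dotProduct_sub, hTT, one_mulVec, h11, sub_nonneg, Complex.real_le_real]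
    exact hV y
  obtain ⟨R, hR⟩ : ∃ R : Matrix κ κ ℂ, 1 - Tᴴ * T = Rᴴ * R := by
    open scoped MatrixOrder in
    exact CStarAlgebra.nonneg_iff_eq_star_mul_self.mp hpos.nonneg
  have hRR : ∀ y, ∑ i, ‖(R *ᵥ y) i‖ ^ 2 ≤ ∑ k, ‖y k‖ ^ 2 := fun y => by
    have h1 := star_dotProduct_conjTranspose_mul_diagonal_mul_mulVec R (fun _ => 1) y
    simp only [Complex.ofReal_one, diagonal_one, mul_one, one_mul, ← hR, sub_mulVec,
      dotProduct_sub, hTT, one_mulVec, h11] at h1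
    norm_cast at h1
    rw [← h1]
    exact sub_le_self _ (Finset.sum_nonneg fun i _ => sq_nonneg _)
  -- A positive lower bound for `d`; the formula also works when `κ` is empty.
  obtain ⟨c, hc0, hc⟩ : ∃ c : ℝ, 0 < c ∧ ∀ k, c ≤ d k := by
    have h0 : ∀ k ∈ Finset.univ, 0 ≤ (d k)⁻¹ := fun k _ => (inv_pos.mpr (hd k)).le
    have hs := Finset.sum_nonneg h0
    refine ⟨(∑ k, (d k)⁻¹ + 1)⁻¹, by positivity, fun k => inv_le_of_inv_le₀ (hd k) ?_⟩
    linarith [Finset.single_le_sum h0 (Finset.mem_univ k)]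
  -- The defect `R` completes the contraction to an isometry. Its rows need a positive weight,
  -- because `f` is controlled only on `(0, ∞)`; the weight `η * c` costs at most `η * d`, as `R†R ≤
  -- 1`.
  have hW : (fromRows T R)ᴴ * fromRows T R = 1 := by
    rw [conjTranspose_fromRows_eq_fromCols_conjTranspose, fromCols_mul_fromRows, ← hR,
      add_sub_cancel]
  refine le_of_forall_le_one_add_mul fun η hη => ?_
  have := hf.sum_le_sum_of_isometry hW (a := Sum.elim a fun _ => η * c)
    (d := fun k => (1 + η) * d k)
    (by rintro (i | k) <;> simp [ha, hη, hc0]) (fun k => by have := hd k; positivity)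
    (fun y => by
      simp only [fromRows_mulVec, Fintype.sum_sum_type, Sum.elim_inl, Sum.elim_inr, add_mul,
        one_mul, Finset.sum_add_distrib]
      refine add_le_add (h y) ?_
      rw [← Finset.mul_sum]
      refine (mul_le_mul_of_nonneg_left (hRR y) (by positivity)).trans ?_
      rw [Finset.mul_sum]
      exact Finset.sum_le_sum fun k _ => mul_le_mul_of_nonneg_right
        (mul_le_mul_of_nonneg_left (hc k) hη.le) (sq_nonneg _)) x
  simp only [fromRows_mulVec, Fintype.sum_sum_type, Sum.elim_inl, Sum.elim_inr] at this
  have hnn : 0 ≤ ∑ k, f (η * c) * ‖(R *ᵥ x) k‖ ^ 2 := Finset.sum_nonneg fun k _ =>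
    mul_nonneg (hf.pos _ (by positivity)).le (sq_nonneg _)
  refine (le_of_add_le_of_nonneg_left this hnn).trans ?_
  rw [Finset.mul_sum]
  refine Finset.sum_le_sum fun k _ => ?_
  rw [← mul_assoc]
  exact mul_le_mul_of_nonneg_right (hf.map_mul_le (hd k) (by linarith)) (sq_nonneg _)

end OperatorInequalities

/-! ### Schur multipliers and their functional calculus -/

section SchurMultipliers

open Matrix

variable {n : Type*} [Fintype n] [DecidableEq n]

/-- The Schur multiplier with symbol `d`, in the orthonormal basis given by the columns of `U`. -/
def schurMultiplier (U : Matrix n n ℂ) (d : n → n → ℝ) : Matrix n n ℂ →ₗ[ℂ] Matrix n n ℂ where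
  toFun A := U * of (fun i j => (d i j : ℂ) * (Uᴴ * A * U) i j) * Uᴴ
  map_add' A B := by
    rw [← Matrix.add_mul, ← Matrix.mul_add]
    congr 2
    ext i j
    simp [Matrix.add_mul, _root_.mul_add]
  map_smul' c A := by
    rw [RingHom.id_apply, ← Matrix.smul_mul, ← Matrix.mul_smul]
    congr 2
    ext i j
    simp [mul_left_comm]

theorem schurMultiplier_apply (U : Matrix n n ℂ) (d : n → n → ℝ) (A : Matrix n n ℂ) :
    schurMultiplier U d A = U * of (fun i j => (d i j : ℂ) * (Uᴴ * A * U) i j) * Uᴴ := rfl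

variable {U : Matrix n n ℂ}

theorem conj_schurMultiplier_apply (hU : Uᴴ * U = 1) (d : n → n → ℝ) (A : Matrix n n ℂ) (i j : n) :
    (Uᴴ * schurMultiplier U d A * U) i j = (d i j : ℂ) * (Uᴴ * A * U) i j := by
  have h : ∀ M : Matrix n n ℂ, Uᴴ * (U * M * Uᴴ) * U = M := fun M => by
    rw [← Matrix.mul_assoc, ← Matrix.mul_assoc, hU, Matrix.one_mul, Matrix.mul_assoc, hU,
      Matrix.mul_one]
  rw [schurMultiplier_apply, h, of_apply]

theorem schurMultiplier_comp (hU : Uᴴ * U = 1) (d e : n → n → ℝ) :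
    schurMultiplier U d ∘ₗ schurMultiplier U e = schurMultiplier U fun i j => d i j * e i j := by
  ext1 A
  rw [LinearMap.comp_apply, schurMultiplier_apply]
  simp only [conj_schurMultiplier_apply hU]
  rw [schurMultiplier_apply]
  simp [mul_assoc]

theorem mulLeft_conj_diagonal (hU : Uᴴ * U = 1) (l : n → ℝ) :
    LinearMap.mulLeft ℂ (U * diagonal (fun i => (l i : ℂ)) * Uᴴ) =
      schurMultiplier U fun i _ => l i := by
  ext1 A
  have : of (fun i j => (l i : ℂ) * (Uᴴ * A * U) i j) =
      diagonal (fun i => (l i : ℂ)) * (Uᴴ * A * U) := by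
    ext i j; simp
  rw [schurMultiplier_apply, this, LinearMap.mulLeft_apply]
  simp only [Matrix.mul_assoc, mul_eq_one_comm.mp hU, Matrix.mul_one]

theorem mulRight_conj_diagonal (hU : Uᴴ * U = 1) (l : n → ℝ) :
    LinearMap.mulRight ℂ (U * diagonal (fun i => (l i : ℂ)) * Uᴴ) =
      schurMultiplier U fun _ j => l j := by
  ext1 A
  have : of (fun i j => (l j : ℂ) * (Uᴴ * A * U) i j) =
      (Uᴴ * A * U) * diagonal (fun i => (l i : ℂ)) := by
    ext i j; simp [mul_comm]
  rw [schurMultiplier_apply, this, LinearMap.mulRight_apply]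
  simp only [← Matrix.mul_assoc, mul_eq_one_comm.mp hU, Matrix.one_mul]

/-- In matrix units the map `A ↦ U A U†` is `U ⊗ Ū`, and a multiplier in the standard basis is
diagonal. For unitary `U` this is a spectral decomposition, so functional calculus acts directly on
symbols. -/
theorem toMatrix_schurMultiplier (U : Matrix n n ℂ) (d : n → n → ℝ) :
    LinearMap.toMatrix (Matrix.stdBasis ℂ n n) (Matrix.stdBasis ℂ n n) (schurMultiplier U d) =
      kroneckerMap (· * ·) U Uᴴᵀ * diagonal (fun p : n × n => (d p.1 p.2 : ℂ)) *
        (kroneckerMap (· * ·) U Uᴴᵀ)ᴴ := by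
  let D : Matrix n n ℂ →ₗ[ℂ] Matrix n n ℂ := schurMultiplier 1 d
  have h : schurMultiplier U d = (LinearMap.mulLeft ℂ U ∘ₗ LinearMap.mulRight ℂ Uᴴ) ∘ₗ D ∘ₗ
      (LinearMap.mulLeft ℂ Uᴴ ∘ₗ LinearMap.mulRight ℂ U) := by
    ext1 A
    simp [D, schurMultiplier_apply, Matrix.mul_assoc]
  have hD : LinearMap.toMatrix (Matrix.stdBasis ℂ n n) (Matrix.stdBasis ℂ n n) D =
      diagonal (fun p : n × n => (d p.1 p.2 : ℂ)) := by
    ext ⟨i, j⟩ ⟨k, l⟩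
    rw [LinearMap.toMatrix_apply, matrix_stdBasis_repr]
    have hki : (k = i) = (i = k) := propext eq_comm
    have hlj : (l = j) = (j = l) := propext eq_comm
    by_cases hik : i = k <;> by_cases hjl : j = l <;>
      simp [D, schurMultiplier_apply, Matrix.stdBasis_eq_single, Matrix.single_apply,
        hki, hlj, hik, hjl]
  rw [h, LinearMap.toMatrix_comp _ (Matrix.stdBasis ℂ n n) _
      (LinearMap.mulLeft ℂ U ∘ₗ LinearMap.mulRight ℂ Uᴴ),
    LinearMap.toMatrix_comp _ (Matrix.stdBasis ℂ n n) _ D, hD, toMatrix_mulLeft_mulRight, toMatrix_mulLeft_mulRight,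
    ← Matrix.mul_assoc]
  congr 1
  ext ⟨i, j⟩ ⟨k, l⟩
  simp

theorem superCalculus_schurMultiplier (hU : Uᴴ * U = 1) (g : ℝ → ℝ) (d : n → n → ℝ) :
    superCalculus g (schurMultiplier U d) = schurMultiplier U fun i j => g (d i j) := by
  have hW : (kroneckerMap (· * ·) U Uᴴᵀ)ᴴ * kroneckerMap (· * ·) U Uᴴᵀ = 1 := by
    rw [conjTranspose_kronecker, ← mul_kronecker_mul, hU]
    have : Uᴴᵀᴴ * Uᴴᵀ = (Uᴴ * U)ᵀ := by
      rw [transpose_mul]; congr 1; ext; simp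
    rw [this, hU, transpose_one, one_kronecker_one]
  rw [superCalculus, toMatrix_schurMultiplier, cfc_conj_diagonal hW (fun p : n × n => d p.1 p.2),
    ← toMatrix_schurMultiplier U fun i j => g (d i j), toLin_toMatrix]

theorem trace_mul_schurMultiplier (U : Matrix n n ℂ) (d : n → n → ℝ) (A B : Matrix n n ℂ) :
    (A * schurMultiplier U d B).trace =
      ∑ i, ∑ j, (d i j : ℂ) * ((Uᴴ * A * U) j i * (Uᴴ * B * U) i j) := by
  rw [schurMultiplier_apply, ← Matrix.mul_assoc, trace_mul_comm, ← Matrix.mul_assoc,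
    ← Matrix.mul_assoc, trace_mul_comm]
  simp only [trace, diag, mul_apply (M := of _), of_apply]
  exact Finset.sum_congr rfl fun i _ => Finset.sum_congr rfl fun j _ => by ring

theorem trace_mul_schurMultiplier_comm (U : Matrix n n ℂ) {d : n → n → ℝ}
    (hd : ∀ i j, d i j = d j i) (A B : Matrix n n ℂ) :
    (A * schurMultiplier U d B).trace = (B * schurMultiplier U d A).trace := by
  rw [trace_mul_schurMultiplier, trace_mul_schurMultiplier, Finset.sum_comm]
  exact Finset.sum_congr rfl fun i _ => Finset.sum_congr rfl fun j _ => by rw [hd]; ring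

theorem conj_conjTranspose_apply {n : Type*} [Fintype n] (U A : Matrix n n ℂ) (i j : n) :
    (Uᴴ * Aᴴ * U) i j = star ((Uᴴ * A * U) j i) := by
  rw [← conjTranspose_apply]
  simp only [conjTranspose_mul, conjTranspose_conjTranspose, Matrix.mul_assoc]

theorem trace_conjTranspose_mul_schurMultiplier (U : Matrix n n ℂ) (d : n → n → ℝ)
    (A : Matrix n n ℂ) : (Aᴴ * schurMultiplier U d A).trace =
      ((∑ i, ∑ j, d i j * ‖(Uᴴ * A * U) i j‖ ^ 2 : ℝ) : ℂ) := by
  rw [trace_mul_schurMultiplier]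
  push_cast
  refine Finset.sum_congr rfl fun i _ => Finset.sum_congr rfl fun j _ => ?_
  rw [conj_conjTranspose_apply, RCLike.star_def, Complex.conj_mul']

theorem schurMultiplier_conjTranspose (U : Matrix n n ℂ) {d : n → n → ℝ}
    (hd : ∀ i j, d i j = d j i) (A : Matrix n n ℂ) :
    schurMultiplier U d Aᴴ = (schurMultiplier U d A)ᴴ := by
  have h : of (fun i j => (d i j : ℂ) * (Uᴴ * Aᴴ * U) i j) =
      (of fun i j => (d i j : ℂ) * (Uᴴ * A * U) i j)ᴴ := by
    ext i j
    simp [conj_conjTranspose_apply, hd j i]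
  rw [schurMultiplier_apply, schurMultiplier_apply, h]
  simp only [conjTranspose_mul, conjTranspose_conjTranspose, Matrix.mul_assoc]

theorem Matrix.IsHermitian.exists_eq_conj_diagonal {A : Matrix n n ℂ} (hA : A.IsHermitian) :
    ∃ V : Matrix n n ℂ, Vᴴ * V = 1 ∧
      A = V * diagonal (fun i => (hA.eigenvalues i : ℂ)) * Vᴴ :=
  ⟨hA.eigenvectorUnitary, Unitary.coe_star_mul_self hA.eigenvectorUnitary, by
    conv_lhs => rw [hA.spectral_theorem]
    rfl⟩

end SchurMultipliers

/-! ### Symbols of the Fisher operators -/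

section FisherSymbols

open Matrix

variable {n : Type*}

/-- The symbol of the quantum Fisher operator of a state with eigenvalues `l`. -/
noncomputable def fisherSymbol (f : ℝ → ℝ) (l : n → ℝ) (i j : n) : ℝ :=
  l j * (Set.Ioi (0 : ℝ)).indicator f (l i * (l j)⁻¹)

/-- The symbol of the inverse quantum Fisher operator of a state with eigenvalues `l`. -/
noncomputable def fisherSymbolInv (f : ℝ → ℝ) (l : n → ℝ) (i j : n) : ℝ :=
  (l j)⁻¹ * (Set.Ioi (0 : ℝ)).indicator (fun x => (f x)⁻¹) (l i * (l j)⁻¹)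

theorem modularOp_conj_diagonal [Fintype n] [DecidableEq n] {U : Matrix n n ℂ}
    (hU : Uᴴ * U = 1) (l : n → ℝ) :
    modularOp (U * diagonal (fun i => (l i : ℂ)) * Uᴴ) =
      schurMultiplier U fun i j => l i * (l j)⁻¹ := by
  rw [modularOp, supportInv, cfc_conj_diagonal hU, mulLeft_conj_diagonal hU,
    mulRight_conj_diagonal hU (fun i => (l i)⁻¹), schurMultiplier_comp hU]

theorem fisherOp_conj_diagonal [Fintype n] [DecidableEq n] {U : Matrix n n ℂ} (hU : Uᴴ * U = 1)
    (f : ℝ → ℝ) (l : n → ℝ) :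
    fisherOp f (U * diagonal (fun i => (l i : ℂ)) * Uᴴ) =
      schurMultiplier U (fisherSymbol f l) := by
  rw [fisherOp, modularOp_conj_diagonal hU, superCalculus_schurMultiplier hU,
    mulRight_conj_diagonal hU, schurMultiplier_comp hU]
  rfl

theorem fisherOpInv_conj_diagonal [Fintype n] [DecidableEq n] {U : Matrix n n ℂ} (hU : Uᴴ * U = 1)
    (f : ℝ → ℝ) (l : n → ℝ) :
    fisherOpInv f (U * diagonal (fun i => (l i : ℂ)) * Uᴴ) =
      schurMultiplier U (fisherSymbolInv f l) := by
  rw [fisherOpInv, modularOp_conj_diagonal hU, superCalculus_schurMultiplier hU, supportInv,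
    cfc_conj_diagonal hU, mulRight_conj_diagonal hU (fun i => (l i)⁻¹), schurMultiplier_comp hU]
  rfl

variable {f : ℝ → ℝ} {l : n → ℝ}

theorem fisherSymbol_of_pos {i j : n} (hi : 0 < l i) (hj : 0 < l j) :
    fisherSymbol f l i j = l j * f (l i / l j) := by
  rw [fisherSymbol, ← div_eq_mul_inv, Set.indicator_of_mem (Set.mem_Ioi.mpr (div_pos hi hj))]

theorem fisherSymbolInv_of_pos {i j : n} (hi : 0 < l i) (hj : 0 < l j) :
    fisherSymbolInv f l i j = (l j * f (l i / l j))⁻¹ := by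
  rw [fisherSymbolInv, ← div_eq_mul_inv, Set.indicator_of_mem (Set.mem_Ioi.mpr (div_pos hi hj)),
    mul_inv]

theorem fisherSymbol_of_eq_zero {i j : n} (h : l i = 0 ∨ l j = 0) : fisherSymbol f l i j = 0 := by
  rcases h with h | h <;> simp [fisherSymbol, h]

theorem fisherSymbolInv_of_eq_zero {i j : n} (h : l i = 0 ∨ l j = 0) :
    fisherSymbolInv f l i j = 0 := by
  rcases h with h | h <;> simp [fisherSymbolInv, h]

/-- Entries that meet the kernel vanish on both sides because `0⁻¹ = 0`, so the entrywise inverse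
also describes singular states. -/
theorem fisherSymbolInv_eq_inv (hl : ∀ i, 0 ≤ l i) (i j : n) :
    fisherSymbolInv f l i j = (fisherSymbol f l i j)⁻¹ := by
  rcases (hl i).eq_or_lt with hi | hi
  · rw [fisherSymbol_of_eq_zero (.inl hi.symm), fisherSymbolInv_of_eq_zero (.inl hi.symm), _root_.inv_zero]
  rcases (hl j).eq_or_lt with hj | hj
  · rw [fisherSymbol_of_eq_zero (.inr hj.symm), fisherSymbolInv_of_eq_zero (.inr hj.symm), _root_.inv_zero]
  rw [fisherSymbol_of_pos hi hj, fisherSymbolInv_of_pos hi hj]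

/-- This is `f x = x * f x⁻¹` at `x = l i / l j`. It is what makes the Fisher operators commute with
the adjoint and makes the Fisher product symmetric. -/
theorem IsStandardMonotone.fisherSymbol_symm (hf : IsStandardMonotone f) (hl : ∀ i, 0 ≤ l i)
    (i j : n) : fisherSymbol f l i j = fisherSymbol f l j i := by
  rcases (hl i).eq_or_lt with hi | hi
  · rw [fisherSymbol_of_eq_zero (.inl hi.symm), fisherSymbol_of_eq_zero (.inr hi.symm)]
  rcases (hl j).eq_or_lt with hj | hj
  · rw [fisherSymbol_of_eq_zero (.inr hj.symm), fisherSymbol_of_eq_zero (.inl hj.symm)]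
  rw [fisherSymbol_of_pos hi hj, fisherSymbol_of_pos hj hi, hf.symmetric _ (div_pos hi hj),
    inv_div, ← mul_assoc, mul_div_cancel₀ _ hj.ne']

theorem IsStandardMonotone.fisherSymbolInv_symm (hf : IsStandardMonotone f) (hl : ∀ i, 0 ≤ l i)
    (i j : n) : fisherSymbolInv f l i j = fisherSymbolInv f l j i := by
  rw [fisherSymbolInv_eq_inv hl, fisherSymbolInv_eq_inv hl, hf.fisherSymbol_symm hl]

theorem IsStandardMonotone.fisherSymbol_pos (hf : IsStandardMonotone f) (hl : ∀ i, 0 < l i)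
    (i j : n) : 0 < fisherSymbol f l i j := by
  rw [fisherSymbol_of_pos (hl i) (hl j)]
  exact mul_pos (hl j) (hf.pos _ (div_pos (hl i) (hl j)))


end FisherSymbols

/-! ### Monotonicity of the Fisher operators under channels -/

section Monotonicity

open Matrix

variable {n m : Type*} [Fintype n] [DecidableEq n] [Fintype m] [DecidableEq m]

/-- The weighted coordinates of a matrix in the orthonormal basis given by the columns of `U`. -/
def conjCoord (U : Matrix n n ℂ) (w : n → n → ℝ) : Matrix n n ℂ →ₗ[ℂ] (n × n → ℂ) where
  toFun A p := (w p.1 p.2 : ℂ) * (Uᴴ * A * U) p.1 p.2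
  map_add' A B := by
    ext p
    simp [Matrix.add_mul, _root_.mul_add]
  map_smul' c A := by
    ext p
    simp [mul_left_comm]

/-- The matrix with given weighted coordinates. -/
def ofConjCoord (U : Matrix n n ℂ) (w : n → n → ℝ) : (n × n → ℂ) →ₗ[ℂ] Matrix n n ℂ where
  toFun x := U * of (fun i j => (w i j : ℂ) * x (i, j)) * Uᴴ
  map_add' x y := by
    rw [← Matrix.add_mul, ← Matrix.mul_add]
    congr 2
    ext i j
    simp [_root_.mul_add]
  map_smul' c x := by
    rw [RingHom.id_apply, ← Matrix.smul_mul, ← Matrix.mul_smul]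
    congr 2
    ext i j
    simp [mul_left_comm]

theorem conj_ofConjCoord_apply {U : Matrix n n ℂ} (hU : Uᴴ * U = 1) (w : n → n → ℝ)
    (x : n × n → ℂ) (i j : n) :
    (Uᴴ * ofConjCoord U w x * U) i j = (w i j : ℂ) * x (i, j) := by
  have h : ∀ M : Matrix n n ℂ, Uᴴ * (U * M * Uᴴ) * U = M := fun M => by
    rw [← Matrix.mul_assoc, ← Matrix.mul_assoc, hU, Matrix.one_mul, Matrix.mul_assoc, hU,
      Matrix.mul_one]
  simp [ofConjCoord, h]

theorem sum_norm_conjCoord_sq (U : Matrix n n ℂ) {c w : n → n → ℝ} {d : n → n → ℝ}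
    (h : ∀ i j, c i j * w i j ^ 2 = d i j) (A : Matrix n n ℂ) :
    ∑ p : n × n, c p.1 p.2 * ‖conjCoord U w A p‖ ^ 2 =
      ∑ i, ∑ j, d i j * ‖(Uᴴ * A * U) i j‖ ^ 2 := by
  rw [Fintype.sum_prod_type]
  refine Finset.sum_congr rfl fun i _ => Finset.sum_congr rfl fun j _ => ?_
  simp only [conjCoord, LinearMap.coe_mk, AddHom.coe_mk, norm_mul, Complex.norm_real,
    Real.norm_eq_abs, mul_pow, sq_abs, ← h]
  ring

theorem trace_mul_conj_diagonal_mul_conjTranspose {U : Matrix n n ℂ} (hU : Uᴴ * U = 1) (l : n → ℝ)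
    (A : Matrix n n ℂ) : (A * (U * diagonal (fun i => (l i : ℂ)) * Uᴴ) * Aᴴ).trace =
      ((∑ i, ∑ j, l j * ‖(Uᴴ * A * U) i j‖ ^ 2 : ℝ) : ℂ) := by
  rw [← trace_conjTranspose_mul_schurMultiplier U fun _ j => l j, ← mulRight_conj_diagonal hU,
    LinearMap.mulRight_apply, trace_mul_comm]

theorem trace_conjTranspose_mul_conj_diagonal_mul {U : Matrix n n ℂ} (hU : Uᴴ * U = 1) (l : n → ℝ)
    (A : Matrix n n ℂ) : (Aᴴ * (U * diagonal (fun i => (l i : ℂ)) * Uᴴ) * A).trace =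
      ((∑ i, ∑ j, l i * ‖(Uᴴ * A * U) i j‖ ^ 2 : ℝ) : ℂ) := by
  rw [← trace_conjTranspose_mul_schurMultiplier U fun i _ => l i, ← mulLeft_conj_diagonal hU,
    LinearMap.mulLeft_apply, Matrix.mul_assoc]

/-- Monotonicity of the quantum Fisher operators, `Φ 𝕁_f|_ρ Φ† ≤ 𝕁_f|_{Φ(ρ)}`, as an inequality
of quadratic forms in eigenbases of `ρ` and `Φ ρ`. -/
theorem IsStandardMonotone.sum_fisherSymbol_hsAdjoint_le {f : ℝ → ℝ} (hf : IsStandardMonotone f)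
    {Φ : Matrix n n ℂ →ₗ[ℂ] Matrix m m ℂ} (hΦ : IsCPTP Φ) {ρ : Matrix n n ℂ}
    {U : Matrix n n ℂ} (hU : Uᴴ * U = 1) {l : n → ℝ} (hl : ∀ i, 0 < l i)
    (hρ : ρ = U * diagonal (fun i => (l i : ℂ)) * Uᴴ)
    {W : Matrix m m ℂ} (hW : Wᴴ * W = 1) {μ : m → ℝ}
    (hσ : Φ ρ = W * diagonal (fun i => (μ i : ℂ)) * Wᴴ) (B : Matrix m m ℂ)
    (hB : ∀ i j, ¬ (0 < μ i ∧ 0 < μ j) → (Wᴴ * B * W) i j = 0) :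
    ∑ i, ∑ j, fisherSymbol f l i j * ‖(Uᴴ * hsAdjoint Φ B * U) i j‖ ^ 2 ≤
      ∑ i, ∑ j, fisherSymbol f μ i j * ‖(Wᴴ * B * W) i j‖ ^ 2 := by
  classical
  have hρ' : ρ.PosSemidef := by
    rw [hρ]
    exact (PosSemidef.diagonal fun i => by simpa using (hl i).le).mul_mul_conjTranspose_same U
  -- The weight `w` implements `ℝ_{Φ(ρ)}^{-1/2}` on the support of `Φ ρ` and `0` off it. There `d`
  -- is the modular eigenvalue; off the support its value `1` only keeps it positive.
  let w : m → m → ℝ := fun i j => if 0 < μ i ∧ 0 < μ j then (√(μ j))⁻¹ else 0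
  let d : m → m → ℝ := fun i j => if 0 < μ i ∧ 0 < μ j then μ i / μ j else 1
  let V : (m × m → ℂ) →ₗ[ℂ] (n × n → ℂ) :=
    conjCoord U (fun _ j => √(l j)) ∘ₗ hsAdjoint Φ ∘ₗ ofConjCoord W w
  have hV : ∀ x, V x = conjCoord U (fun _ j => √(l j)) (hsAdjoint Φ (ofConjCoord W w x)) :=
    fun x => rfl
  have hsq : ∀ j, √(l j) ^ 2 = l j := fun j => Real.sq_sqrt (hl j).le
  have hd : ∀ i j, 0 < d i j := fun i j => by
    simp only [d]; split_ifs with h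
    · exact div_pos h.1 h.2
    · exact one_pos
  have hw1 : ∀ i j, μ j * w i j ^ 2 ≤ 1 := fun i j => by
    simp only [w]; split_ifs with h
    · rw [inv_pow, Real.sq_sqrt h.2.le, mul_inv_cancel₀ h.2.ne']
    · simp
  have hw2 : ∀ i j, μ i * w i j ^ 2 ≤ d i j := fun i j => by
    simp only [w, d]; split_ifs with h
    · rw [inv_pow, Real.sq_sqrt h.2.le, div_eq_mul_inv]
    · simp
  have hle1 : ∀ x, ∑ p, ‖V x p‖ ^ 2 ≤ ∑ p, ‖x p‖ ^ 2 := fun x => by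
    have h1 := sum_norm_conjCoord_sq U (c := fun _ _ => 1) (w := fun _ j => √(l j))
      (d := fun _ j => l j) (fun i j => by rw [hsq, one_mul]) (hsAdjoint Φ (ofConjCoord W w x))
    have h2 := trace_hsAdjoint_schwarz hΦ hρ' (ofConjCoord W w x)
    rw [hσ, hρ, trace_mul_conj_diagonal_mul_conjTranspose hU,
      trace_mul_conj_diagonal_mul_conjTranspose hW, Complex.real_le_real] at h2
    simp only [one_mul] at h1
    rw [hV, h1]
    refine h2.trans ?_
    rw [Fintype.sum_prod_type]
    refine Finset.sum_le_sum fun i _ => Finset.sum_le_sum fun j _ => ?_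
    rw [conj_ofConjCoord_apply hW, norm_mul, Complex.norm_real, Real.norm_eq_abs, mul_pow, sq_abs,
      ← mul_assoc]
    exact mul_le_of_le_one_left (sq_nonneg _) (hw1 i j)
  -- The modular weight turns right multiplication by `ρ` into left multiplication, so the Schwarz
  -- inequality is now applied to the adjoint matrix.
  have hle2 : ∀ x, ∑ p : n × n, l p.1 / l p.2 * ‖V x p‖ ^ 2 ≤
      ∑ p : m × m, d p.1 p.2 * ‖x p‖ ^ 2 := fun x => by
    have h1 := sum_norm_conjCoord_sq U (c := fun i j => l i / l j) (w := fun _ j => √(l j))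
      (d := fun i _ => l i) (fun i j => by rw [hsq, div_mul_cancel₀ _ (hl j).ne'])
      (hsAdjoint Φ (ofConjCoord W w x))
    have h2 := trace_hsAdjoint_schwarz hΦ hρ' (ofConjCoord W w x)ᴴ
    rw [hsAdjoint_conjTranspose hΦ, conjTranspose_conjTranspose, conjTranspose_conjTranspose,
      hσ, hρ, trace_conjTranspose_mul_conj_diagonal_mul hU,
      trace_conjTranspose_mul_conj_diagonal_mul hW, Complex.real_le_real] at h2
    rw [hV, h1]
    refine h2.trans ?_
    rw [Fintype.sum_prod_type]
    refine Finset.sum_le_sum fun i _ => Finset.sum_le_sum fun j _ => ?_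
    rw [conj_ofConjCoord_apply hW, norm_mul, Complex.norm_real, Real.norm_eq_abs, mul_pow, sq_abs,
      ← mul_assoc]
    exact mul_le_mul_of_nonneg_right (hw2 i j) (sq_nonneg _)
  -- The coordinates of `B ℝ`-multiplied by the square root of `Φ ρ`; `hB` ensures that nothing is
  -- lost off the support.
  let x : m × m → ℂ := fun p => (√(μ p.2) : ℂ) * (Wᴴ * B * W) p.1 p.2
  have hx : ofConjCoord W w x = B := by
    have : of (fun i j => (w i j : ℂ) * x (i, j)) = Wᴴ * B * W := by
      ext i j
      by_cases h : 0 < μ i ∧ 0 < μ j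
      · have hne : (√(μ j) : ℂ) ≠ 0 := by simpa using (Real.sqrt_pos.mpr h.2).ne'
        simp [x, w, h, hne]
      · simp [x, hB i j h]
    have hW' := mul_eq_one_comm.mp hW
    change W * of (fun i j => (w i j : ℂ) * x (i, j)) * Wᴴ = B
    rw [this, ← Matrix.mul_assoc, ← Matrix.mul_assoc, hW', Matrix.one_mul, Matrix.mul_assoc, hW',
      Matrix.mul_one]
  have key := hf.sum_le_sum_of_contraction V (a := fun p => l p.1 / l p.2)
    (d := fun p => d p.1 p.2) (fun p => div_pos (hl _) (hl _)) (fun p => hd _ _) hle1 hle2 x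
  have hL := sum_norm_conjCoord_sq U (c := fun i j => f (l i / l j)) (w := fun _ j => √(l j))
    (d := fisherSymbol f l) (fun i j => by rw [hsq, fisherSymbol_of_pos (hl i) (hl j), mul_comm])
    (hsAdjoint Φ B)
  rw [hV, hx, hL, Fintype.sum_prod_type] at key
  refine key.trans (le_of_eq ?_)
  refine Finset.sum_congr rfl fun i _ => Finset.sum_congr rfl fun j _ => ?_
  by_cases h : 0 < μ i ∧ 0 < μ j
  · simp only [x, d, h, and_self, if_true, norm_mul, Complex.norm_real, Real.norm_eq_abs, mul_pow,
      sq_abs, Real.sq_sqrt h.2.le, fisherSymbol_of_pos h.1 h.2]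
    ring
  · simp [x, hB i j h]

/-- `⟨S, 𝕁_f|_ρ S⟩ ≤ 1` for a density matrix `ρ` and a Hermitian unitary `S`. -/
theorem IsStandardMonotone.sum_fisherSymbol_le_one {f : ℝ → ℝ} (hf : IsStandardMonotone f)
    {ρ : Matrix n n ℂ} (hρ1 : ρ.trace = 1) {U : Matrix n n ℂ} (hU : Uᴴ * U = 1) {l : n → ℝ}
    (hl : ∀ i, 0 < l i) (hρ : ρ = U * diagonal (fun i => (l i : ℂ)) * Uᴴ) {S : Matrix n n ℂ}
    (hS : Sᴴ = S) (hSS : S * S = 1) :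
    ∑ i, ∑ j, fisherSymbol f l i j * ‖(Uᴴ * S * U) i j‖ ^ 2 ≤ 1 := by
  -- The map `c ↦ c • S ρ^{1/2}` in coordinates. Its plain and modular-weighted squared norms are
  -- `Tr(S ρ S) = Tr ρ = 1`, so Jensen with `d = 1` and `f 1 = 1` gives the bound.
  let V : (Unit → ℂ) →ₗ[ℂ] (n × n → ℂ) :=
    (LinearMap.proj ()).smulRight (conjCoord U (fun _ j => √(l j)) S)
  have hsq : ∀ j, √(l j) ^ 2 = l j := fun j => Real.sq_sqrt (hl j).le
  have hV : ∀ (c : n × n → ℝ) x, ∑ p, c p * ‖V x p‖ ^ 2 =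
      (∑ p, c p * ‖conjCoord U (fun _ j => √(l j)) S p‖ ^ 2) * ‖x ()‖ ^ 2 := fun c x => by
    simp only [V, LinearMap.smulRight_apply, LinearMap.proj_apply, Pi.smul_apply, norm_smul,
      mul_pow, Finset.sum_mul]
    exact Finset.sum_congr rfl fun p _ => by ring
  have h1 := sum_norm_conjCoord_sq U (c := fun _ _ => 1) (w := fun _ j => √(l j))
    (d := fun _ j => l j) (fun i j => by rw [hsq, one_mul]) S
  have h2 := sum_norm_conjCoord_sq U (c := fun i j => l i / l j) (w := fun _ j => √(l j))
    (d := fun i _ => l i) (fun i j => by rw [hsq, div_mul_cancel₀ _ (hl j).ne']) S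
  have h3 := sum_norm_conjCoord_sq U (c := fun i j => f (l i / l j)) (w := fun _ j => √(l j))
    (d := fisherSymbol f l) (fun i j => by rw [hsq, fisherSymbol_of_pos (hl i) (hl j), mul_comm]) S
  have t1 := trace_mul_conj_diagonal_mul_conjTranspose hU l S
  have t2 := trace_conjTranspose_mul_conj_diagonal_mul hU l S
  rw [← hρ, hS, Matrix.mul_assoc, trace_mul_comm, Matrix.mul_assoc, hSS, Matrix.mul_one, hρ1] at t1
  rw [← hρ, hS, Matrix.mul_assoc, trace_mul_comm, Matrix.mul_assoc, hSS, Matrix.mul_one, hρ1] at t2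
  norm_cast at t1 t2
  rw [← t1] at h1
  rw [← t2] at h2
  have key := hf.sum_le_sum_of_contraction V (a := fun p => l p.1 / l p.2) (d := fun _ => 1)
    (fun p => div_pos (hl _) (hl _)) (fun _ => one_pos)
    (fun x => by
      have := hV (fun _ => 1) x
      simp only [one_mul] at this h1
      rw [this, h1]
      simp)
    (fun x => by
      rw [hV (fun p => l p.1 / l p.2), h2]
      simp) (fun _ => 1)
  rw [hV (fun p => f (l p.1 / l p.2)), h3] at key
  simpa [hf.map_one] using key

end Monotonicity

/-! ### Fisher information and the trace norm -/

section TraceNormBound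

open Matrix
open scoped MatrixOrder

variable {n : Type*} [Fintype n] [DecidableEq n]

/-- The trace norm of a Hermitian matrix is attained on a Hermitian unitary. -/
theorem exists_traceNorm_eq {X : Matrix n n ℂ} (hX : X.IsHermitian) :
    ∃ S : Matrix n n ℂ, Sᴴ = S ∧ S * S = 1 ∧ traceNorm X = (S * X).trace.re := by
  obtain ⟨V, hV, hXV⟩ := hX.exists_eq_conj_diagonal
  set x := hX.eigenvalues
  -- The sign at eigenvalue `0` must be nonzero, so that `S * S = 1`.
  let s : n → ℂ := fun i => if 0 ≤ x i then 1 else -1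
  have hmul : ∀ a b : n → ℂ, (V * diagonal a * Vᴴ) * (V * diagonal b * Vᴴ) =
      V * diagonal (fun i => a i * b i) * Vᴴ := fun a b => by
    rw [← diagonal_mul_diagonal]
    calc _ = V * diagonal a * (Vᴴ * V) * diagonal b * Vᴴ := by simp only [Matrix.mul_assoc]
      _ = _ := by rw [hV]; simp only [Matrix.mul_assoc, Matrix.mul_one]
  refine ⟨V * diagonal s * Vᴴ, ?_, ?_, ?_⟩
  · have : star s = s := by
      ext i
      simp only [s, Pi.star_apply]
      split_ifs <;> simp
    simp only [conjTranspose_mul, conjTranspose_conjTranspose, diagonal_conjTranspose, this,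
      Matrix.mul_assoc]
  · have : (fun i => s i * s i) = fun _ => 1 := by
      ext i
      simp only [s]
      split_ifs <;> simp
    rw [hmul, this, diagonal_one, Matrix.mul_one, mul_eq_one_comm.mp hV]
  · have habs : CFC.abs X = cfc (fun r : ℝ => |r|) X := by
      simpa [Real.norm_eq_abs] using CFC.abs_eq_cfc_norm X hX.isSelfAdjoint
    rw [traceNorm, habs]
    conv_lhs => rw [hXV, cfc_conj_diagonal hV]
    conv_rhs => rw [hXV, hmul]
    congr 5
    ext i
    simp only [s]
    split_ifs with h
    · rw [abs_of_nonneg h, one_mul]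
    · rw [abs_of_neg (not_le.mp h)]; simp

/-- The quantum Fisher information dominates the square of the trace norm. -/
theorem IsStandardMonotone.sq_traceNorm_le {f : ℝ → ℝ} (hf : IsStandardMonotone f)
    {ρ : Matrix n n ℂ} (hρ : ρ.PosDef) (hρ1 : ρ.trace = 1) {X : Matrix n n ℂ}
    (hX : X.IsHermitian) : ((traceNorm X ^ 2 : ℝ) : ℂ) ≤ fisherInfo f ρ X := by
  obtain ⟨U, hU, hUρ⟩ := hρ.isHermitian.exists_eq_conj_diagonal
  have hl := hρ.eigenvalues_pos
  set l := hρ.isHermitian.eigenvalues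
  obtain ⟨S, hS, hSS, hXS⟩ := exists_traceNorm_eq hX
  have hK : ∀ i j, fisherSymbolInv f l i j = (fisherSymbol f l i j)⁻¹ :=
    fisherSymbolInv_eq_inv fun i => (hl i).le
  have hJ : ∀ i j, 0 < fisherSymbol f l i j := hf.fisherSymbol_pos hl
  have h1 := hf.sum_fisherSymbol_le_one hρ1 hU hl hUρ hS hSS
  have hI : fisherInfo f ρ X =
      ((∑ i, ∑ j, fisherSymbolInv f l i j * ‖(Uᴴ * X * U) i j‖ ^ 2 : ℝ) : ℂ) := by
    rw [← trace_conjTranspose_mul_schurMultiplier, hX.eq, fisherInfo, fisherProduct]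
    conv_lhs => rw [hUρ, fisherOpInv_conj_diagonal hU]
  -- Cauchy-Schwarz with the symbol on the side of `S` and its inverse on the side of `X`.
  have hcs : (∑ p : n × n, ‖(Uᴴ * S * U) p.1 p.2‖ * ‖(Uᴴ * X * U) p.1 p.2‖) ^ 2 ≤
      (∑ p : n × n, fisherSymbol f l p.1 p.2 * ‖(Uᴴ * S * U) p.1 p.2‖ ^ 2) *
        ∑ p : n × n, fisherSymbolInv f l p.1 p.2 * ‖(Uᴴ * X * U) p.1 p.2‖ ^ 2 := by
    refine Finset.sum_sq_le_sum_mul_sum_of_sq_le_mul _ (fun p _ => ?_) (fun p _ => ?_)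
      fun p _ => ?_
    · exact mul_nonneg (hJ _ _).le (sq_nonneg _)
    · rw [hK]; exact mul_nonneg (inv_pos.mpr (hJ _ _)).le (sq_nonneg _)
    · rw [hK, mul_pow]
      have := (hJ p.1 p.2).ne'
      exact le_of_eq (by field_simp)
  have htr : |traceNorm X| ≤ ∑ p : n × n, ‖(Uᴴ * S * U) p.1 p.2‖ * ‖(Uᴴ * X * U) p.1 p.2‖ := by
    have h := trace_mul_schurMultiplier U (fun _ _ => 1) S X
    have hone : schurMultiplier U (fun _ _ => 1) X = X := by
      rw [← mulLeft_conj_diagonal hU fun _ => 1]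
      simp [mul_eq_one_comm.mp hU]
    rw [hone] at h
    rw [hXS, Fintype.sum_prod_type, h]
    refine (Complex.abs_re_le_norm _).trans ((norm_sum_le _ _).trans
      (Finset.sum_le_sum fun i _ => (norm_sum_le _ _).trans
        (Finset.sum_le_sum fun j _ => le_of_eq ?_)))
    have hS' := conj_conjTranspose_apply U S j i
    rw [hS] at hS'
    rw [hS', norm_mul, norm_mul, norm_star]
    simp
  rw [hI, Complex.real_le_real, ← sq_abs]
  simp only [Fintype.sum_prod_type] at hcs htr
  refine (pow_le_pow_left₀ (abs_nonneg _) htr 2).trans (hcs.trans ?_)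
  refine mul_le_of_le_one_left (Finset.sum_nonneg fun i _ => Finset.sum_nonneg fun j _ => ?_) h1
  rw [hK]
  exact mul_nonneg (inv_pos.mpr (hJ _ _)).le (sq_nonneg _)

end TraceNormBound

/-! ### Symmetry of the Fisher operators and the key inequality -/

section FisherOperators

open Matrix

variable {n m : Type*} [Fintype n] [DecidableEq n] [Fintype m] [DecidableEq m] {f f' : ℝ → ℝ}

theorem IsStandardMonotone.trace_mul_fisherOpInv_comm (hf : IsStandardMonotone f)
    {π : Matrix n n ℂ} (hπ : π.PosSemidef) (A B : Matrix n n ℂ) :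
    (A * fisherOpInv f π B).trace = (B * fisherOpInv f π A).trace := by
  obtain ⟨U, hU, hUπ⟩ := hπ.isHermitian.exists_eq_conj_diagonal
  rw [hUπ, fisherOpInv_conj_diagonal hU]
  exact trace_mul_schurMultiplier_comm U (hf.fisherSymbolInv_symm hπ.eigenvalues_nonneg) A B

theorem IsStandardMonotone.fisherOp_conjTranspose (hf : IsStandardMonotone f)
    {π : Matrix n n ℂ} (hπ : π.PosSemidef) (A : Matrix n n ℂ) :
    fisherOp f π Aᴴ = (fisherOp f π A)ᴴ := by
  obtain ⟨U, hU, hUπ⟩ := hπ.isHermitian.exists_eq_conj_diagonal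
  rw [hUπ, fisherOp_conj_diagonal hU]
  exact schurMultiplier_conjTranspose U (hf.fisherSymbol_symm hπ.eigenvalues_nonneg) A

theorem IsStandardMonotone.fisherOpInv_conjTranspose (hf : IsStandardMonotone f)
    {π : Matrix n n ℂ} (hπ : π.PosSemidef) (A : Matrix n n ℂ) :
    fisherOpInv f π Aᴴ = (fisherOpInv f π A)ᴴ := by
  obtain ⟨U, hU, hUπ⟩ := hπ.isHermitian.exists_eq_conj_diagonal
  rw [hUπ, fisherOpInv_conj_diagonal hU]
  exact schurMultiplier_conjTranspose U (hf.fisherSymbolInv_symm hπ.eigenvalues_nonneg) A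

/-- `⟨Φ†B, 𝕁_{f'}|_ρ Φ†B⟩ ≤ ⟨E, B⟩` for `B = 𝕁_f⁻¹|_{Φ(ρ)} E` with `E` Hermitian. -/
theorem IsStandardMonotone.trace_hsAdjoint_mul_fisherOp_le (hf : IsStandardMonotone f)
    (hle : ∀ x : ℝ, 0 < x → f' x ≤ f x) {Φ : Matrix n n ℂ →ₗ[ℂ] Matrix m m ℂ} (hΦ : IsCPTP Φ)
    {ρ : Matrix n n ℂ} (hρ : ρ.PosDef) {E : Matrix m m ℂ} (hE : E.IsHermitian) :
    (hsAdjoint Φ (fisherOpInv f (Φ ρ) E) *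
      fisherOp f' ρ (hsAdjoint Φ (fisherOpInv f (Φ ρ) E))).trace ≤
      (E * fisherOpInv f (Φ ρ) E).trace := by
  have hσ := hΦ.map_posSemidef hρ.posSemidef
  obtain ⟨U, hU, hUρ⟩ := hρ.isHermitian.exists_eq_conj_diagonal
  obtain ⟨W, hW, hWσ⟩ := hσ.isHermitian.exists_eq_conj_diagonal
  have hl := hρ.eigenvalues_pos
  have hμ := hσ.eigenvalues_nonneg
  set l := hρ.isHermitian.eigenvalues
  set μ := hσ.isHermitian.eigenvalues
  have hK : fisherOpInv f (Φ ρ) = schurMultiplier W (fisherSymbolInv f μ) := by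
    conv_lhs => rw [hWσ, fisherOpInv_conj_diagonal hW]
  have hJ : fisherOp f' ρ = schurMultiplier U (fisherSymbol f' l) := by
    conv_lhs => rw [hUρ, fisherOp_conj_diagonal hU]
  have hB : (fisherOpInv f (Φ ρ) E)ᴴ = fisherOpInv f (Φ ρ) E := by
    rw [← hf.fisherOpInv_conjTranspose hσ, hE.eq]
  set B := fisherOpInv f (Φ ρ) E with hBdef
  have hY : (hsAdjoint Φ B)ᴴ = hsAdjoint Φ B := by rw [← hsAdjoint_conjTranspose hΦ, hB]
  have hcoord : ∀ i j, (Wᴴ * B * W) i j = (fisherSymbolInv f μ i j : ℂ) * (Wᴴ * E * W) i j :=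
    fun i j => by rw [hBdef, hK, conj_schurMultiplier_apply hW]
  have hB0 : ∀ i j, ¬ (0 < μ i ∧ 0 < μ j) → (Wᴴ * B * W) i j = 0 := fun i j h => by
    have : μ i = 0 ∨ μ j = 0 := by
      by_contra! h'
      exact h ⟨(hμ i).lt_of_ne' h'.1, (hμ j).lt_of_ne' h'.2⟩
    rw [hcoord, fisherSymbolInv_of_eq_zero this]
    simp
  have key := hf.sum_fisherSymbol_hsAdjoint_le hΦ hU hl hUρ hW hWσ B hB0
  have e1 := trace_conjTranspose_mul_schurMultiplier U (fisherSymbol f' l) (hsAdjoint Φ B)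
  have e2 := trace_conjTranspose_mul_schurMultiplier W (fisherSymbolInv f μ) E
  rw [hY, ← hJ] at e1
  rw [hE.eq, ← hK, ← hBdef] at e2
  rw [e1, e2, Complex.real_le_real]
  refine le_trans ?_ (key.trans (le_of_eq ?_))
  · refine Finset.sum_le_sum fun i _ => Finset.sum_le_sum fun j _ =>
      mul_le_mul_of_nonneg_right ?_ (sq_nonneg _)
    rw [fisherSymbol_of_pos (hl i) (hl j), fisherSymbol_of_pos (hl i) (hl j)]
    exact mul_le_mul_of_nonneg_left (hle _ (div_pos (hl i) (hl j))) (hl j).le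
  · refine Finset.sum_congr rfl fun i _ => Finset.sum_congr rfl fun j _ => ?_
    rw [hcoord, norm_mul, Complex.norm_real, Real.norm_eq_abs, mul_pow, sq_abs,
      fisherSymbolInv_eq_inv hμ, ← mul_assoc]
    congr 1
    by_cases h : fisherSymbol f μ i j = 0
    · simp [h]
    · field_simp

end FisherOperators

/-- All traces below are complex numbers; `z ≤ w` in `ℂ` means that `w - z` is a nonnegative real
number, so the inequalities also say that the quantities in the chain are real. -/
theorem mainTheorem6 {n m : Type*} [Fintype n] [DecidableEq n] [Fintype m] [DecidableEq m]
    (Φ : Matrix n n ℂ →ₗ[ℂ] Matrix m m ℂ) (hΦ : IsCPTP Φ)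
    (f f' : ℝ → ℝ) (hf : IsStandardMonotone f) (hf' : IsStandardMonotone f')
    (hle : ∀ x : ℝ, 0 < x → f' x ≤ f x)
    (ρ σ : Matrix n n ℂ) (hρ : ρ.PosDef) (hρ1 : ρ.trace = 1)
    (hσ : σ.PosSemidef) (hσ1 : σ.trace = 1) :
    chiSq f' ρ σ - chiSq f (Φ ρ) (Φ σ) =
        ((ρ - σ) * fisherOpInv f' ρ (recoveryDefect f' f ρ Φ (ρ - σ))).trace ∧
      fisherInfo f' ρ (recoveryDefect f' f ρ Φ (ρ - σ)) ≤
        ((ρ - σ) * fisherOpInv f' ρ (recoveryDefect f' f ρ Φ (ρ - σ))).trace ∧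
      ((traceNorm (recoveryDefect f' f ρ Φ (ρ - σ)) ^ 2 : ℝ) : ℂ) ≤
        fisherInfo f' ρ (recoveryDefect f' f ρ Φ (ρ - σ)) := by
  have hΔ : (ρ - σ).IsHermitian := hρ.isHermitian.sub hσ.isHermitian
  rw [chiSq, chiSq, ← map_sub]
  set Δ := ρ - σ
  have hE : (Φ Δ).IsHermitian := by rw [Matrix.IsHermitian, ← hΦ.map_conjTranspose, hΔ.eq]
  have hτ := hΦ.map_posSemidef hρ.posSemidef
  have hB := hf.fisherOpInv_conjTranspose hτ (Φ Δ)
  have hkey := hf.trace_hsAdjoint_mul_fisherOp_le hle hΦ hρ hE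
  set B := fisherOpInv f (Φ ρ) (Φ Δ) with hBdef
  set Y := hsAdjoint Φ B with hYdef
  set Z := fisherOp f' ρ Y with hZdef
  have hX : recoveryDefect f' f ρ Φ Δ = Δ - Z := by
    simp [recoveryDefect, generalisedPetz, hZdef, hYdef, hBdef]
  have hZ : fisherOpInv f' ρ Z = Y := by
    rw [hZdef, ← LinearMap.comp_apply, fisherOpInv_comp_fisherOp hf'.pos hρ, LinearMap.id_apply]
  have hZH : Z.IsHermitian := by
    rw [hE.eq] at hB
    rw [Matrix.IsHermitian, hZdef, ← hf'.fisherOp_conjTranspose hρ.posSemidef, hYdef,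
      ← hsAdjoint_conjTranspose hΦ, ← hB]
  have hΔY : (Δ * Y).trace = (Φ Δ * B).trace := trace_mul_hsAdjoint hΦ Δ B
  rw [hX]
  refine ⟨?_, ?_, hf'.sq_traceNorm_le hρ hρ1 (hΔ.sub hZH)⟩
  · rw [map_sub _ Δ Z, hZ, Matrix.mul_sub, Matrix.trace_sub, hΔY]
  -- Expanding only the left factor `Δ - Z` leaves the subtracted term `K(Z, Δ - Z)`, which becomes
  -- `Tr(E B) - Tr(Y Z)` with `E = Φ Δ`; `hkey` makes it nonnegative.
  · rw [fisherInfo, fisherProduct, Matrix.sub_mul, Matrix.trace_sub, map_sub _ Δ Z, hZ, Matrix.mul_sub Z,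
      Matrix.trace_sub, hf'.trace_mul_fisherOpInv_comm hρ.posSemidef Z Δ, hZ, hΔY,
      Matrix.trace_mul_comm Z Y]
    exact sub_le_self _ (sub_nonneg.mpr hkey)
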